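/- **Proposition (Continuous-displacement branching clusters lie in the $L^1$ regime).** Let $C$ be a rooted branching cluster on $\mathbb R$: its genealogy $\mathcal T$ is a random rooted tree, labelled by finite words over a countable alphabet and almost surely finite; the root is placed at $0$, every other vertex $v$ is placed at the sum $X_v$ of the displacements along the edges on the path from the root to $v$; and $C=\sum_{v\in\mathcal T}\delta_{X_v}$. Assume that, conditionally on $\mathcal T$, the edge displacements are independent and each has a Lebesgue density on $\mathbb R$ (which may depend on $\mathcal T$ and on the edge; densities concentrated on $(0,\infty)$ are allowed), and that $\mathbb E[C(\mathbb R)^3]<\infty$. Let $\nu>0$ and let $$N=\sum_j \vartheta_{U_j}C_j$$ be the stationary Poisson cluster process generated by $C$, where $\{U_j\}$ is a homogeneous Poisson process on $\mathbb R$ with rate $\nu$, the $C_j$ are i.i.d. copies of $C$ independent of $\{U_j\}$, and $\vartheta_u$ denotes translation by $u$. For bounded, compactly supported Borel functions $f_j$ on $\mathbb R$ let $\alpha_n(f_1,\dots,f_n)=\mathbb E\sum^{\ne}_{x_1,\dots,x_n\in N}\prod_j f_j(x_j)$ (sum over ordered $n$-tuples of distinct points of $N$) be the factorial moment measures, and let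 $$\kappa_3(f_0,f_1,f_2)=\alpha_3(f_0,f_1,f_2)-\alpha_2(f_0,f_1)\alpha_1(f_2)-\alpha_2(f_0,f_2)\alpha_1(f_1)-\alpha_2(f_1,f_2)\alpha_1(f_0)+2\,\alpha_1(f_0)\alpha_1(f_1)\alpha_1(f_2)$$ be the third factorial cumulant measure of $N$. The reduced third factorial cumulant measure of $N$ is the finite signed measure $\kappa_3^{\mathrm{red}}$ on $\mathbb R^2$ with $$\kappa_3(f_0,f_1,f_2)=\int_{\mathbb R}\int_{\mathbb R^2}f_0(t)\,f_1(t+\tau_1)\,f_2(t+\tau_2)\,\kappa_3^{\mathrm{red}}(d\tau_1,d\tau_2)\,dt .$$ Then $N$ has locally finite moment measures up to order three, the measure $\kappa_3^{\mathrm{red}}$ exists, and it is absolutely continuous with a density $c_3\in L^1(\mathbb R^2)$. Moreover, $$\int_{\mathbb R^2}c_3(\tau_1,\tau_2)\,d\tau_1\,d\tau_2=\nu\,\mathbb E\big[(C(\mathbb R))_3\big],\qquad (M)_3:=M(M-1)(M-2).$$ -/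

import Mathlib

open MeasureTheory ProbabilityTheory Set
open scoped NNReal ENNReal

noncomputable section

namespace PoissonCluster

/-! ### Factorial moments and third factorial cumulants of point processes on the line

A point process is a random counting measure `N : Ω → Measure ℝ` (points are counted with
multiplicity).  Below `∫ x, f x ∂N` is `N(f)`, the sum of `f` over the points of `N`. -/

/-- The sum of `f x * g y` over the ordered pairs of distinct points of the counting measure `N`:
all pairs, minus the pairs in which the same point occurs twice. -/
def pairSum (N : Measure ℝ) (f g : ℝ → ℝ) : ℝ :=
  (∫ x, f x ∂N) * (∫ x, g x ∂N) - ∫ x, f x * g x ∂N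

/-- The sum of `f x * g y * h z` over the ordered triples of pairwise distinct points of the
counting measure `N`, by inclusion-exclusion (see `tripleSum_sum_dirac`). -/
def tripleSum (N : Measure ℝ) (f g h : ℝ → ℝ) : ℝ :=
  (∫ x, f x ∂N) * (∫ x, g x ∂N) * (∫ x, h x ∂N)
    - (∫ x, f x * g x ∂N) * (∫ x, h x ∂N)
    - (∫ x, f x * h x ∂N) * (∫ x, g x ∂N)
    - (∫ x, g x * h x ∂N) * (∫ x, f x ∂N)
    + 2 * ∫ x, f x * g x * h x ∂N

/-- For labelled atoms, `tripleSum` is the sum over triples of pairwise distinct labels. -/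
theorem tripleSum_sum_dirac {ι : Type*} [DecidableEq ι] (s : Finset ι) (x : ι → ℝ)
    (f g h : ℝ → ℝ) :
    tripleSum (∑ i ∈ s, Measure.dirac (x i)) f g h =
      ∑ i ∈ s, ∑ j ∈ s, ∑ k ∈ s,
        if i ≠ j ∧ i ≠ k ∧ j ≠ k then f (x i) * g (x j) * h (x k) else 0 := by
  have key : ∀ φ : ℝ → ℝ, ∫ y, φ y ∂(∑ i ∈ s, Measure.dirac (x i)) = ∑ i ∈ s, φ (x i) := by
    intro φ
    rw [integral_finsetSum_measure (fun i _ => integrable_dirac (by simp))]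
    simp
  have hsplit : ∀ i j k : ι,
      (if i ≠ j ∧ i ≠ k ∧ j ≠ k then f (x i) * g (x j) * h (x k) else 0) =
        f (x i) * g (x j) * h (x k)
          - (if i = j then f (x i) * g (x i) * h (x k) else 0)
          - (if i = k then f (x i) * h (x i) * g (x j) else 0)
          - (if j = k then g (x j) * h (x j) * f (x i) else 0)
          + 2 * (if i = j then (if i = k then f (x i) * g (x i) * h (x i) else 0) else 0) := by
    intro i j k
    by_cases h1 : i = j <;> by_cases h2 : i = k <;> by_cases h3 : j = k <;>
      simp_all <;> ring
  simp only [tripleSum, key, hsplit, Finset.sum_add_distrib, Finset.sum_sub_distrib,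
    ← Finset.mul_sum]
  have e1 : ∑ i ∈ s, ∑ j ∈ s, ∑ k ∈ s, (if i = j then f (x i) * g (x i) * h (x k) else 0) =
      (∑ i ∈ s, f (x i) * g (x i)) * ∑ k ∈ s, h (x k) := by
    rw [Finset.sum_mul_sum]
    refine Finset.sum_congr rfl fun i hi => ?_
    rw [Finset.sum_comm]
    simp [hi]
  have e2 : ∑ i ∈ s, ∑ j ∈ s, ∑ k ∈ s, (if i = k then f (x i) * h (x i) * g (x j) else 0) =
      (∑ i ∈ s, f (x i) * h (x i)) * ∑ k ∈ s, g (x k) := by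
    rw [Finset.sum_mul_sum]
    refine Finset.sum_congr rfl fun i hi => ?_
    simp [hi]
  have e3 : ∑ i ∈ s, ∑ j ∈ s, ∑ k ∈ s, (if j = k then g (x j) * h (x j) * f (x i) else 0) =
      (∑ i ∈ s, g (x i) * h (x i)) * ∑ k ∈ s, f (x k) := by
    rw [Finset.sum_mul_sum, Finset.sum_comm]
    refine Finset.sum_congr rfl fun i hi => ?_
    simp [hi]
  have e4 : ∑ i ∈ s, ∑ j ∈ s, ∑ k ∈ s,
      (if i = j then (if i = k then f (x i) * g (x i) * h (x i) else 0) else 0) =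
      ∑ i ∈ s, f (x i) * g (x i) * h (x i) := by
    refine Finset.sum_congr rfl fun i hi => ?_
    rw [Finset.sum_comm]
    simp [hi]
  rw [e1, e2, e3, e4]
  simp only [← Finset.mul_sum, ← Finset.sum_mul]

section Moments

variable {Ω : Type*} [MeasurableSpace Ω]

/-- First factorial moment measure `α₁` of the point process `N`, tested against `f`. -/
def factorialMoment₁ (N : Ω → Measure ℝ) (μ : Measure Ω) (f : ℝ → ℝ) : ℝ :=
  ∫ ω, ∫ x, f x ∂(N ω) ∂μ

/-- Second factorial moment measure `α₂` of `N`, tested against `f ⊗ g`. -/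
def factorialMoment₂ (N : Ω → Measure ℝ) (μ : Measure Ω) (f g : ℝ → ℝ) : ℝ :=
  ∫ ω, pairSum (N ω) f g ∂μ

/-- Third factorial moment measure `α₃` of `N`, tested against `f ⊗ g ⊗ h`. -/
def factorialMoment₃ (N : Ω → Measure ℝ) (μ : Measure Ω) (f g h : ℝ → ℝ) : ℝ :=
  ∫ ω, tripleSum (N ω) f g h ∂μ

/-- Third factorial cumulant measure `κ₃` of `N`, tested against `f ⊗ g ⊗ h`: the coefficient of
`s₀ s₁ s₂` in the logarithm of the factorial moment generating functional
`E ∏ (1 + s₀ f + s₁ g + s₂ h) = 1 + s₀ α₁(f) + ⋯ + s₀ s₁ α₂(f, g) + ⋯ + s₀ s₁ s₂ α₃(f, g, h) + ⋯`,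
that is, its mixed derivative at the origin. -/
def thirdFactorialCumulant (N : Ω → Measure ℝ) (μ : Measure Ω) (f g h : ℝ → ℝ) : ℝ :=
  factorialMoment₃ N μ f g h
    - factorialMoment₂ N μ f g * factorialMoment₁ N μ h
    - factorialMoment₂ N μ f h * factorialMoment₁ N μ g
    - factorialMoment₂ N μ g h * factorialMoment₁ N μ f
    + 2 * (factorialMoment₁ N μ f * factorialMoment₁ N μ g * factorialMoment₁ N μ h)

/-- Bounded, compactly supported Borel test functions on the line. -/
structure IsTest (f : ℝ → ℝ) : Prop where
  measurable : Measurable f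
  bounded : ∃ b, ∀ x, |f x| ≤ b
  compact_support : HasCompactSupport f

/-- The finite signed measure `κ` on `ℝ²` is the reduced third factorial cumulant measure of the
point process `N`.  The first field says that the moment measures of `N` up to order three are
locally finite, so that `κ₃` is well defined; the second one is
`κ₃(dt₀, dt₁, dt₂) = κ(dτ₁, dτ₂) dt₀` with `t₁ = t₀ + τ₁`, `t₂ = t₀ + τ₂`. -/
structure IsReducedThirdFactorialCumulant (N : Ω → Measure ℝ) (μ : Measure Ω)
    (κ : SignedMeasure (ℝ × ℝ)) : Prop where
  moment_lt_top : ∀ K : Set ℝ, IsCompact K → ∫⁻ ω, (N ω K) ^ 3 ∂μ < ∞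
  disintegration : ∀ f₀ f₁ f₂ : ℝ → ℝ, IsTest f₀ → IsTest f₁ → IsTest f₂ →
    thirdFactorialCumulant N μ f₀ f₁ f₂ =
      ∫ t : ℝ, ∫ᵛ τ : ℝ × ℝ, f₀ t * f₁ (t + τ.1) * f₂ (t + τ.2) ∂<•κ

end Moments

/-! ### Rooted branching clusters

The vertices of the genealogy are labelled by finite words over `ℕ`; the root is the empty word and
the parent of `v ++ [i]` is `v`.  `T ω` is the set of vertices of the genealogy, and `D v ω` is the
displacement along the edge from the parent of `v` to `v`. -/

/-- Position of the vertex `v`: the sum of the displacements `D u` along the path from the root to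
`v`, where `u` runs over the nonempty prefixes of `v`.  The root is at the origin. -/
def position (D : List ℕ → ℝ) (v : List ℕ) : ℝ :=
  ∑ k ∈ Finset.range v.length, D (v.take (k + 1))

section Cluster

variable {Ω : Type*} [MeasurableSpace Ω]

/-- A random rooted tree `T` that is almost surely finite, together with edge displacements which,
conditionally on the tree, are independent and have Lebesgue densities (these densities may depend
on the tree and on the edge).  A finite tree takes countably many values, so conditioning on `T` is
conditioning on the events `T = τ` of positive probability. -/
structure IsBranchingCluster (T : Ω → Set (List ℕ)) (D : List ℕ → Ω → ℝ) (P : Measure Ω) :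
    Prop where
  measurable_tree : Measurable T
  measurable_displacement : ∀ v, Measurable (D v)
  root_mem : ∀ᵐ ω ∂P, [] ∈ T ω
  parent_mem : ∀ᵐ ω ∂P, ∀ (v : List ℕ) (i : ℕ), v ++ [i] ∈ T ω → v ∈ T ω
  finite : ∀ᵐ ω ∂P, (T ω).Finite
  indep : ∀ τ : Finset (List ℕ), P {ω | T ω = (τ : Set (List ℕ))} ≠ 0 →
    iIndepFun (fun (v : {v : List ℕ // v ∈ τ ∧ v ≠ []}) => D v)
      (P[|{ω | T ω = (τ : Set (List ℕ))}])
  density : ∀ τ : Finset (List ℕ), P {ω | T ω = (τ : Set (List ℕ))} ≠ 0 →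
    ∀ v ∈ τ, v ≠ [] → HasPDF (D v) (P[|{ω | T ω = (τ : Set (List ℕ))}]) volume

/-- The cluster `C` as a random counting measure: one unit atom at the position of each vertex. -/
def cluster (T : Ω → Set (List ℕ)) (D : List ℕ → Ω → ℝ) (ω : Ω) : Measure ℝ :=
  Measure.sum fun v : T ω => Measure.dirac (position (fun u => D u ω) v)

/-- `U` enumerates the points of a homogeneous Poisson process on the line with rate `ν`: the number
of points in a Borel set `B` of finite length is Poisson with mean `ν |B|`, and the numbers of
points in pairwise disjoint Borel sets of finite length are independent. -/
structure IsHomogeneousPoisson (U : ℕ → Ω → ℝ) (ν : ℝ≥0) (μ : Measure Ω) : Prop where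
  measurable : ∀ j, Measurable (U j)
  law : ∀ B : Set ℝ, MeasurableSet B → volume B ≠ ∞ →
    μ.map (fun ω => (Measure.sum fun j => Measure.dirac (U j ω)) B) =
      (poissonMeasure (ν * (volume B).toNNReal)).map (fun n : ℕ => (n : ℝ≥0∞))
  indep : ∀ (n : ℕ) (B : Fin n → Set ℝ), (∀ i, MeasurableSet (B i)) →
    (∀ i, volume (B i) ≠ ∞) → Pairwise (fun i j => Disjoint (B i) (B j)) →
    iIndepFun (fun i ω => (Measure.sum fun j => Measure.dirac (U j ω)) (B i)) μ

/-- The superposition `N = ∑ⱼ ϑ_{Uⱼ} Cⱼ` of the clusters `C j` translated to the points `U j`. -/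
def clusterProcess (U : ℕ → Ω → ℝ) (C : ℕ → Ω → Measure ℝ) (ω : Ω) : Measure ℝ :=
  Measure.sum fun j => (C j ω).map (fun x => x + U j ω)

/-- `U` and `C` are the immigrants and clusters of a stationary Poisson cluster process with
immigrant rate `ν` generated by the random measure `C₀` (defined on a probability space with
measure `P`): the `C j` are i.i.d. copies of `C₀`, independent of the Poisson process `U`. -/
structure IsPoissonClusterSystem {Ω₀ : Type*} [MeasurableSpace Ω₀] (U : ℕ → Ω → ℝ)
    (C : ℕ → Ω → Measure ℝ) (ν : ℝ≥0) (μ : Measure Ω) (C₀ : Ω₀ → Measure ℝ) (P : Measure Ω₀) :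
    Prop where
  poisson : IsHomogeneousPoisson U ν μ
  measurable_cluster : ∀ j, Measurable (C j)
  identDistrib : ∀ j, IdentDistrib (C j) C₀ μ P
  indep_clusters : iIndepFun C μ
  indep_immigrants : IndepFun (fun ω j => U j ω) (fun ω j => C j ω) μ

end Cluster

end PoissonCluster

end

/-! The third cumulant sees only triples of points inside one cluster. The marked points `(U j, C
j)` behave, up to order three, like a Poisson process on `ℝ × Measure ℝ` with intensity `(ν •
volume).prod L`, where `L` is the law of the cluster. Expanding the factorial moments of `N` over
the ways in which three points are shared among clusters, all products of two or more integrals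
cancel in the cumulant. What remains is `ν ∫ E[tripleSum C (f₀(· + u)) (f₁(· + u)) (f₂(· + u))] du`
(`HasCompactMoments.thirdFactorialCumulant_eq` and its specialization to cluster processes).

Let `Λ` be the sum, over triples of distinct vertices, of the laws of their positions (`tripleLaw`).
It is a finite measure because the third moment of the cluster size is finite, and its mass is
`E[(C(ℝ))₃]`. Substituting `t = x₀ + u` (`integral_translates_eq`) shows that the reduced measure is
`ν` times the image of `Λ` under `(x₀, x₁, x₂) ↦ (x₁ - x₀, x₂ - x₀)`.

For absolute continuity it is enough to fix one of the countably many finite trees `τ`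
(`map_tripleLaw_absolutelyContinuous`). Given `T = τ`, the position of a vertex is the sum of the
independent displacements selected by the 0/1 vector of the edges on its path, and distinct vertices
have distinct vectors (`indicator_prefix_ne`). Three distinct vertices of a cube are not collinear
(`surjective_of_zero_one`), so the two position differences form a surjective linear image in `ℝ²`
of a vector with an absolutely continuous law. Such an image is absolutely continuous
(`map_linear_absolutelyContinuous`). -/

namespace PoissonCluster

/-! ### Factorial moment measures of a sequence of random points -/

section FactorialMeasures

variable {Ω E : Type*} [MeasurableSpace Ω] [MeasurableSpace E]

/-- The intensity measure of the point process with points `V j`. -/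
noncomputable def intensityMeasure (V : ℕ → Ω → E) (μ : Measure Ω) : Measure E :=
  Measure.sum fun i => μ.map (V i)

/-- The second factorial moment measure of the point process with points `V j`. -/
noncomputable def pairMeasure (V : ℕ → Ω → E) (μ : Measure Ω) : Measure (E × E) :=
  Measure.sum fun p : ℕ × ℕ =>
    if p.1 = p.2 then 0 else μ.map fun ω => (V p.1 ω, V p.2 ω)

/-- The third factorial moment measure of the point process with points `V j`. -/
noncomputable def tripleMeasure (V : ℕ → Ω → E) (μ : Measure Ω) : Measure (E × E × E) :=
  Measure.sum fun p : ℕ × ℕ × ℕ =>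
    if p.1 ≠ p.2.1 ∧ p.1 ≠ p.2.2 ∧ p.2.1 ≠ p.2.2 then
      μ.map fun ω => (V p.1 ω, V p.2.1 ω, V p.2.2 ω) else 0

theorem tsum_pair_split (a : ℕ → ℕ → ℝ≥0∞) :
    ∑' p : ℕ × ℕ, a p.1 p.2 = ∑' p : ℕ × ℕ, (if p.1 = p.2 then 0 else a p.1 p.2) + ∑' i, a i i := by
  have h : ∑' i, a i i = ∑' p : ℕ × ℕ, (if p.1 = p.2 then a p.1 p.2 else 0) := by
    rw [ENNReal.tsum_prod (f := fun i j => if i = j then a i j else 0)]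
    refine tsum_congr fun i => ?_
    simp
  rw [h, ← ENNReal.tsum_add]
  refine tsum_congr fun p => ?_
  split_ifs <;> simp

/-- The five terms correspond to the five partitions of a three-element index set, according to
which indices coincide. -/
theorem tsum_triple_split (a : ℕ → ℕ → ℕ → ℝ≥0∞) :
    ∑' p : ℕ × ℕ × ℕ, a p.1 p.2.1 p.2.2 =
      ∑' p : ℕ × ℕ × ℕ, (if p.1 ≠ p.2.1 ∧ p.1 ≠ p.2.2 ∧ p.2.1 ≠ p.2.2 then
        a p.1 p.2.1 p.2.2 else 0)
      + ∑' p : ℕ × ℕ, (if p.1 = p.2 then 0 else a p.1 p.1 p.2)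
      + ∑' p : ℕ × ℕ, (if p.1 = p.2 then 0 else a p.1 p.2 p.1)
      + ∑' p : ℕ × ℕ, (if p.1 = p.2 then 0 else a p.2 p.1 p.1)
      + ∑' i, a i i i := by
  have h1 : ∑' p : ℕ × ℕ, (if p.1 = p.2 then 0 else a p.1 p.1 p.2) =
      ∑' p : ℕ × ℕ × ℕ, (if p.1 = p.2.1 ∧ p.1 ≠ p.2.2 then a p.1 p.2.1 p.2.2 else 0) := by
    rw [ENNReal.tsum_prod (f := fun i j => if i = j then 0 else a i i j),
      ENNReal.tsum_prod (f := fun i (q : ℕ × ℕ) => if i = q.1 ∧ i ≠ q.2 then a i q.1 q.2 else 0)]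
    refine tsum_congr fun i => ?_
    rw [ENNReal.tsum_prod (f := fun j k => if i = j ∧ i ≠ k then a i j k else 0),
      ENNReal.tsum_comm]
    refine tsum_congr fun k => ?_
    rw [tsum_eq_single i (fun j hj => by simp [hj.symm])]
    by_cases h : i = k <;> simp [h]
  have h2 : ∑' p : ℕ × ℕ, (if p.1 = p.2 then 0 else a p.1 p.2 p.1) =
      ∑' p : ℕ × ℕ × ℕ, (if p.1 = p.2.2 ∧ p.1 ≠ p.2.1 then a p.1 p.2.1 p.2.2 else 0) := by
    rw [ENNReal.tsum_prod (f := fun i j => if i = j then 0 else a i j i),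
      ENNReal.tsum_prod (f := fun i (q : ℕ × ℕ) => if i = q.2 ∧ i ≠ q.1 then a i q.1 q.2 else 0)]
    refine tsum_congr fun i => ?_
    rw [ENNReal.tsum_prod (f := fun j k => if i = k ∧ i ≠ j then a i j k else 0)]
    refine tsum_congr fun k => ?_
    rw [tsum_eq_single i (fun j hj => by simp [hj.symm])]
    by_cases h : i = k <;> simp [h]
  have h3 : ∑' p : ℕ × ℕ, (if p.1 = p.2 then 0 else a p.2 p.1 p.1) =
      ∑' p : ℕ × ℕ × ℕ, (if p.2.1 = p.2.2 ∧ p.1 ≠ p.2.1 then a p.1 p.2.1 p.2.2 else 0) := by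
    rw [ENNReal.tsum_prod (f := fun i j => if i = j then 0 else a j i i), ENNReal.tsum_comm,
      ENNReal.tsum_prod (f := fun i (q : ℕ × ℕ) => if q.1 = q.2 ∧ i ≠ q.1 then a i q.1 q.2 else 0)]
    refine tsum_congr fun i => ?_
    rw [ENNReal.tsum_prod (f := fun j k => if j = k ∧ i ≠ j then a i j k else 0)]
    refine tsum_congr fun k => ?_
    rw [tsum_eq_single k (fun j hj => by simp [hj.symm])]
    by_cases h : i = k <;> simp [h, eq_comm]
  have h4 : ∑' i, a i i i =
      ∑' p : ℕ × ℕ × ℕ, (if p.1 = p.2.1 ∧ p.1 = p.2.2 then a p.1 p.2.1 p.2.2 else 0) := by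
    rw [ENNReal.tsum_prod (f := fun i (q : ℕ × ℕ) => if i = q.1 ∧ i = q.2 then a i q.1 q.2 else 0)]
    refine tsum_congr fun i => ?_
    rw [tsum_eq_single (i, i)]
    · simp
    · rintro ⟨j, k⟩ h
      simp only [ne_eq, Prod.mk.injEq] at h
      rw [if_neg]
      rintro ⟨rfl, rfl⟩
      exact h ⟨rfl, rfl⟩
  rw [h1, h2, h3, h4, ← ENNReal.tsum_add, ← ENNReal.tsum_add, ← ENNReal.tsum_add,
    ← ENNReal.tsum_add]
  refine tsum_congr fun p => ?_
  obtain ⟨i, j, k⟩ := p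
  by_cases h1 : i = j <;> by_cases h2 : i = k <;> by_cases h3 : j = k <;> simp_all

variable {V : ℕ → Ω → E} {μ : Measure Ω}

theorem measurable_points (hV : ∀ i, Measurable (V i)) :
    Measurable fun q : Ω × ℕ => V q.2 q.1 :=
  measurable_from_prod_countable_left fun i => hV i

/-- Sums over points are written as integrals against `Measure.count`. Moment formulas then become a
change of variables plus Fubini, for nonnegative and for signed functions alike. -/
theorem map_prod_count_pair [SFinite μ] (hV : ∀ i, Measurable (V i)) :
    (μ.prod (Measure.count : Measure (ℕ × ℕ))).map
        (fun q => (V q.2.1 q.1, V q.2.2 q.1)) =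
      pairMeasure V μ + (intensityMeasure V μ).map (fun x => (x, x)) := by
  have hm : Measurable fun q : Ω × ℕ × ℕ => (V q.2.1 q.1, V q.2.2 q.1) :=
    measurable_from_prod_countable_left fun p => (hV p.1).prodMk (hV p.2)
  ext s hs
  rw [Measure.map_apply hm hs, Measure.prod_apply_symm (hm hs), lintegral_count, Measure.add_apply,
    Measure.map_apply (by fun_prop) hs, pairMeasure, intensityMeasure, Measure.sum_apply _ hs,
    Measure.sum_apply _ ((by fun_prop : Measurable fun x : E => (x, x)) hs)]
  have key := tsum_pair_split (fun i j => μ ((fun ω => (V i ω, V j ω)) ⁻¹' s))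
  refine (Eq.trans (tsum_congr fun p => rfl) key).trans ?_
  congr 1
  · refine tsum_congr fun p => ?_
    split_ifs
    · simp
    · rw [Measure.map_apply ((hV _).prodMk (hV _)) hs]
  · refine tsum_congr fun p => ?_
    rw [Measure.map_apply (hV _) ((by fun_prop : Measurable fun x : E => (x, x)) hs)]
    rfl

theorem map_prod_count_triple [SFinite μ] (hV : ∀ i, Measurable (V i)) :
    (μ.prod (Measure.count : Measure (ℕ × ℕ × ℕ))).map
        (fun q => (V q.2.1 q.1, V q.2.2.1 q.1, V q.2.2.2 q.1)) =
      tripleMeasure V μ + (pairMeasure V μ).map (fun x => (x.1, x.1, x.2))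
        + (pairMeasure V μ).map (fun x => (x.1, x.2, x.1))
        + (pairMeasure V μ).map (fun x => (x.2, x.1, x.1))
        + (intensityMeasure V μ).map (fun x => (x, x, x)) := by
  have hm : Measurable fun q : Ω × ℕ × ℕ × ℕ => (V q.2.1 q.1, V q.2.2.1 q.1, V q.2.2.2 q.1) :=
    measurable_from_prod_countable_left fun p =>
      (hV p.1).prodMk ((hV p.2.1).prodMk (hV p.2.2))
  have g1 : Measurable fun x : E × E => (x.1, x.1, x.2) := by fun_prop
  have g2 : Measurable fun x : E × E => (x.1, x.2, x.1) := by fun_prop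
  have g3 : Measurable fun x : E × E => (x.2, x.1, x.1) := by fun_prop
  have g4 : Measurable fun x : E => (x, x, x) := by fun_prop
  have pair : ∀ {g : E × E → E × E × E}, Measurable g → ∀ {s : Set (E × E × E)}, MeasurableSet s →
      (pairMeasure V μ).map g s = ∑' p : ℕ × ℕ, if p.1 = p.2 then 0 else
        μ ((fun ω => g (V p.1 ω, V p.2 ω)) ⁻¹' s) := by
    intro g hg s hs
    rw [Measure.map_apply hg hs, pairMeasure, Measure.sum_apply _ (hg hs)]
    refine tsum_congr fun p => ?_
    split_ifs
    · simp
    · rw [Measure.map_apply ((hV _).prodMk (hV _)) (hg hs)]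
      rfl
  ext s hs
  rw [Measure.map_apply hm hs, Measure.prod_apply_symm (hm hs), lintegral_count]
  simp only [Measure.add_apply]
  rw [pair g1 hs, pair g2 hs, pair g3 hs, Measure.map_apply g4 hs, tripleMeasure, intensityMeasure,
    Measure.sum_apply _ hs, Measure.sum_apply _ (g4 hs)]
  have key := tsum_triple_split (fun i j k => μ ((fun ω => (V i ω, V j ω, V k ω)) ⁻¹' s))
  refine (Eq.trans (tsum_congr fun p => rfl) key).trans ?_
  congr 1
  · congr 3
    refine tsum_congr fun p => ?_
    split_ifs
    · rw [Measure.map_apply ((hV _).prodMk ((hV _).prodMk (hV _))) hs]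
    · simp
  · refine tsum_congr fun p => ?_
    rw [Measure.map_apply (hV _) (g4 hs)]
    rfl

theorem count_prod_count (α β : Type*) [MeasurableSpace α] [MeasurableSpace β] [Countable α]
    [Countable β] [MeasurableSingletonClass α] [MeasurableSingletonClass β] :
    (Measure.count : Measure (α × β)) = Measure.count.prod Measure.count := by
  refine Measure.ext_of_singleton fun p => ?_
  rw [← Set.singleton_prod_singleton, Measure.prod_prod, Set.singleton_prod_singleton]
  simp

/-- Expectation of a product of three sums over the points, for nonnegative functions. -/
theorem lintegral_tsum_mul_mul [SFinite μ] (hV : ∀ i, Measurable (V i)) {F G H : E → ℝ≥0∞}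
    (hF : Measurable F) (hG : Measurable G) (hH : Measurable H) :
    ∫⁻ ω, (∑' i, F (V i ω)) * ((∑' i, G (V i ω)) * ∑' i, H (V i ω)) ∂μ =
      ∫⁻ x, F x.1 * (G x.2.1 * H x.2.2) ∂(tripleMeasure V μ)
        + ∫⁻ x, F x.1 * (G x.1 * H x.2) ∂(pairMeasure V μ)
        + ∫⁻ x, F x.1 * (G x.2 * H x.1) ∂(pairMeasure V μ)
        + ∫⁻ x, F x.2 * (G x.1 * H x.1) ∂(pairMeasure V μ)
        + ∫⁻ x, F x * (G x * H x) ∂(intensityMeasure V μ) := by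
  have hm : Measurable fun q : Ω × ℕ × ℕ × ℕ => (V q.2.1 q.1, V q.2.2.1 q.1, V q.2.2.2 q.1) :=
    measurable_from_prod_countable_left fun p =>
      (hV p.1).prodMk ((hV p.2.1).prodMk (hV p.2.2))
  have hP : Measurable fun x : E × E × E => F x.1 * (G x.2.1 * H x.2.2) := by fun_prop
  have hc : Measurable fun q : Ω × ℕ × ℕ × ℕ =>
      F (V q.2.1 q.1) * (G (V q.2.2.1 q.1) * H (V q.2.2.2 q.1)) := hP.comp hm
  have key := congrArg (fun m => ∫⁻ x, F x.1 * (G x.2.1 * H x.2.2) ∂m) (map_prod_count_triple (μ := μ) hV)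
  simp only [lintegral_add_measure] at key
  rw [lintegral_map hP hm, lintegral_map hP (by fun_prop), lintegral_map hP (by fun_prop),
    lintegral_map hP (by fun_prop), lintegral_map hP (by fun_prop),
    lintegral_prod _ hc.aemeasurable] at key
  rw [← key]
  refine lintegral_congr fun ω => ?_
  rw [count_prod_count, count_prod_count, lintegral_prod_mul (f := fun i => F (V i ω))
    (g := fun q : ℕ × ℕ => G (V q.1 ω) * H (V q.2 ω)) (by fun_prop) (by fun_prop),
    lintegral_prod_mul (f := fun i => G (V i ω)) (g := fun i => H (V i ω)) (by fun_prop)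
    (by fun_prop)]
  simp [lintegral_count]

theorem lintegral_tsum_mul [SFinite μ] (hV : ∀ i, Measurable (V i)) {F G : E → ℝ≥0∞}
    (hF : Measurable F) (hG : Measurable G) :
    ∫⁻ ω, (∑' i, F (V i ω)) * (∑' i, G (V i ω)) ∂μ =
      ∫⁻ x, F x.1 * G x.2 ∂(pairMeasure V μ) + ∫⁻ x, F x * G x ∂(intensityMeasure V μ) := by
  have hm : Measurable fun q : Ω × ℕ × ℕ => (V q.2.1 q.1, V q.2.2 q.1) :=
    measurable_from_prod_countable_left fun p => (hV p.1).prodMk (hV p.2)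
  have hP : Measurable fun x : E × E => F x.1 * G x.2 := by fun_prop
  have hc : Measurable fun q : Ω × ℕ × ℕ => F (V q.2.1 q.1) * G (V q.2.2 q.1) := hP.comp hm
  have key := congrArg (fun m => ∫⁻ x, F x.1 * G x.2 ∂m) (map_prod_count_pair (μ := μ) hV)
  simp only [lintegral_add_measure] at key
  rw [lintegral_map hP hm, lintegral_map hP (by fun_prop),
    lintegral_prod _ hc.aemeasurable] at key
  rw [← key]
  refine lintegral_congr fun ω => ?_
  rw [count_prod_count, lintegral_prod_mul (f := fun i => F (V i ω))
    (g := fun i => G (V i ω)) (by fun_prop) (by fun_prop)]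
  simp [lintegral_count]

theorem lintegral_tsum_points (hV : ∀ i, Measurable (V i)) {F : E → ℝ≥0∞} (hF : Measurable F) :
    ∫⁻ ω, ∑' i, F (V i ω) ∂μ = ∫⁻ x, F x ∂(intensityMeasure V μ) := by
  rw [intensityMeasure, lintegral_sum_measure, lintegral_tsum (fun i => by fun_prop)]
  exact tsum_congr fun i => (lintegral_map hF (hV i)).symm

end FactorialMeasures

/-! ### Campbell formulas up to order three -/

section PoissonMoments

variable {Ω E : Type*} [MeasurableSpace Ω] [MeasurableSpace E]

/-- The first three factorial moment measures of the points `V j` are those of a Poisson process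
with intensity `m`. -/
structure IsPoissonToOrderThree (V : ℕ → Ω → E) (μ : Measure Ω) (m : Measure E) : Prop where
  measurable : ∀ i, Measurable (V i)
  intensity : intensityMeasure V μ = m
  pair : pairMeasure V μ = m.prod m
  triple : tripleMeasure V μ = m.prod (m.prod m)

variable {V : ℕ → Ω → E} {μ : Measure Ω} {m : Measure E} [SFinite μ]

theorem IsPoissonToOrderThree.integral_sum (h : IsPoissonToOrderThree V μ m) {F : E → ℝ}
    (hF : Integrable F m) :
    Integrable (fun ω => ∫ i, F (V i ω) ∂Measure.count) μ ∧
      ∫ ω, ∫ i, F (V i ω) ∂Measure.count ∂μ = ∫ x, F x ∂m := by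
  have hm : Measurable fun q : Ω × ℕ => V q.2 q.1 := measurable_points h.measurable
  have hmap : (μ.prod (Measure.count : Measure ℕ)).map (fun q => V q.2 q.1) = m := by
    rw [← h.intensity]
    ext s hs
    rw [Measure.map_apply hm hs, Measure.prod_apply_symm (hm hs), lintegral_count, intensityMeasure,
      Measure.sum_apply _ hs]
    refine tsum_congr fun p => ?_
    rw [Measure.map_apply (h.measurable p) hs]
    rfl
  rw [← hmap] at hF
  have hI : Integrable (fun q : Ω × ℕ => F (V q.2 q.1)) (μ.prod Measure.count) :=
    (integrable_map_measure hF.1 hm.aemeasurable).1 hF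
  refine ⟨hI.integral_prod_left, ?_⟩
  rw [← hmap, integral_map hm.aemeasurable hF.1, integral_prod _ hI]

variable [SFinite m]

theorem IsPoissonToOrderThree.integral_mul (h : IsPoissonToOrderThree V μ m) {F G : E → ℝ}
    (hF : Integrable F m) (hG : Integrable G m) (hFG : Integrable (fun x => F x * G x) m)
    (hFm : Measurable F) (hGm : Measurable G) :
    Integrable (fun ω => (∫ i, F (V i ω) ∂Measure.count) * ∫ i, G (V i ω) ∂Measure.count) μ ∧
      ∫ ω, (∫ i, F (V i ω) ∂Measure.count) * ∫ i, G (V i ω) ∂Measure.count ∂μ =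
        (∫ x, F x ∂m) * (∫ x, G x ∂m) + ∫ x, F x * G x ∂m := by
  have hm : Measurable fun q : Ω × ℕ × ℕ => (V q.2.1 q.1, V q.2.2 q.1) :=
    measurable_from_prod_countable_left fun p => (h.measurable p.1).prodMk (h.measurable p.2)
  have hmap := map_prod_count_pair (μ := μ) h.measurable
  rw [h.pair, h.intensity] at hmap
  have hP : Measurable fun x : E × E => F x.1 * G x.2 := by fun_prop
  have i1 : Integrable (fun x : E × E => F x.1 * G x.2) (m.prod m) := hF.mul_prod hG
  have i2 : Integrable (fun x : E × E => F x.1 * G x.2) (m.map fun x => (x, x)) :=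
    (integrable_map_measure hP.aestronglyMeasurable (by fun_prop)).2 hFG
  have hK := i1.add_measure i2
  have hval : ∫ x, F x.1 * G x.2 ∂(m.prod m + m.map fun x => (x, x)) =
      (∫ x, F x ∂m) * (∫ x, G x ∂m) + ∫ x, F x * G x ∂m := by
    rw [integral_add_measure i1 i2, integral_prod_mul,
      integral_map (by fun_prop) hP.aestronglyMeasurable]
  rw [← hmap] at hK hval
  have hI : Integrable (fun q : Ω × ℕ × ℕ => F (V q.2.1 q.1) * G (V q.2.2 q.1))
      (μ.prod Measure.count) := (integrable_map_measure hK.1 hm.aemeasurable).1 hK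
  have hpt : ∀ ω, ∫ p, F (V p.1 ω) * G (V p.2 ω) ∂(Measure.count : Measure (ℕ × ℕ)) =
      (∫ i, F (V i ω) ∂Measure.count) * ∫ i, G (V i ω) ∂Measure.count := fun ω => by
    rw [count_prod_count, integral_prod_mul (fun i => F (V i ω)) (fun i => G (V i ω))]
  have h1 := hI.integral_prod_left
  rw [integral_map hm.aemeasurable hK.1, integral_prod _ hI] at hval
  simp only [hpt] at h1 hval
  exact ⟨h1, hval⟩

/-- One product of integrals per partition of `{F, G, H}`. The integrability hypotheses are those of
the blocks, which is what a signed Fubini argument requires. -/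
theorem IsPoissonToOrderThree.integral_mul_mul (h : IsPoissonToOrderThree V μ m) {F G H : E → ℝ}
    (hF : Integrable F m) (hG : Integrable G m) (hH : Integrable H m)
    (hFG : Integrable (fun x => F x * G x) m) (hFH : Integrable (fun x => F x * H x) m)
    (hGH : Integrable (fun x => G x * H x) m) (hFGH : Integrable (fun x => F x * G x * H x) m)
    (hFm : Measurable F) (hGm : Measurable G) (hHm : Measurable H) :
    Integrable (fun ω => (∫ i, F (V i ω) ∂Measure.count) * (∫ i, G (V i ω) ∂Measure.count)
        * ∫ i, H (V i ω) ∂Measure.count) μ ∧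
      ∫ ω, (∫ i, F (V i ω) ∂Measure.count) * (∫ i, G (V i ω) ∂Measure.count)
          * ∫ i, H (V i ω) ∂Measure.count ∂μ =
        (∫ x, F x ∂m) * (∫ x, G x ∂m) * (∫ x, H x ∂m)
          + (∫ x, F x * G x ∂m) * (∫ x, H x ∂m) + (∫ x, F x * H x ∂m) * (∫ x, G x ∂m)
          + (∫ x, G x * H x ∂m) * (∫ x, F x ∂m) + ∫ x, F x * G x * H x ∂m := by
  have hm : Measurable fun q : Ω × ℕ × ℕ × ℕ => (V q.2.1 q.1, V q.2.2.1 q.1, V q.2.2.2 q.1) :=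
    measurable_from_prod_countable_left fun p =>
      (h.measurable p.1).prodMk ((h.measurable p.2.1).prodMk (h.measurable p.2.2))
  have hmap := map_prod_count_triple (μ := μ) h.measurable
  rw [h.pair, h.intensity, h.triple] at hmap
  set Φ : E × E × E → ℝ := fun x => F x.1 * (G x.2.1 * H x.2.2) with hΦ
  have hP : Measurable Φ := by fun_prop
  have i0 : Integrable Φ (m.prod (m.prod m)) := hF.mul_prod (hG.mul_prod hH)
  have i1 : Integrable Φ ((m.prod m).map fun x => (x.1, x.1, x.2)) :=
    (integrable_map_measure hP.aestronglyMeasurable (by fun_prop)).2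
      ((hFG.mul_prod hH).congr (ae_of_all _ fun x => by simp [hΦ]; ring))
  have i2 : Integrable Φ ((m.prod m).map fun x => (x.1, x.2, x.1)) :=
    (integrable_map_measure hP.aestronglyMeasurable (by fun_prop)).2
      ((hFH.mul_prod hG).congr (ae_of_all _ fun x => by simp [hΦ]; ring))
  have i3 : Integrable Φ ((m.prod m).map fun x => (x.2, x.1, x.1)) :=
    (integrable_map_measure hP.aestronglyMeasurable (by fun_prop)).2
      ((hGH.mul_prod hF).congr (ae_of_all _ fun x => by simp [hΦ]; ring))
  have i4 : Integrable Φ (m.map fun x => (x, x, x)) :=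
    (integrable_map_measure hP.aestronglyMeasurable (by fun_prop)).2
      (hFGH.congr (ae_of_all _ fun x => by simp [hΦ]; ring))
  have i01 := i0.add_measure i1
  have i012 := i01.add_measure i2
  have i0123 := i012.add_measure i3
  have hK := i0123.add_measure i4
  have hval := integral_add_measure i0123 i4
  rw [integral_add_measure i012 i3, integral_add_measure i01 i2, integral_add_measure i0 i1,
    integral_map (by fun_prop) hP.aestronglyMeasurable,
    integral_map (by fun_prop) hP.aestronglyMeasurable,
    integral_map (by fun_prop) hP.aestronglyMeasurable,
    integral_map (by fun_prop) hP.aestronglyMeasurable] at hval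
  have e0 : ∫ x, Φ x ∂(m.prod (m.prod m)) =
      (∫ x, F x ∂m) * (∫ x, G x ∂m) * (∫ x, H x ∂m) := by
    rw [hΦ, integral_prod_mul F (fun x : E × E => G x.1 * H x.2), integral_prod_mul, mul_assoc]
  have e1 : ∫ x : E × E, Φ (x.1, x.1, x.2) ∂(m.prod m) =
      (∫ x, F x * G x ∂m) * (∫ x, H x ∂m) := by
    rw [← integral_prod_mul]
    exact integral_congr_ae (ae_of_all _ fun x => by simp [hΦ]; ring)
  have e2 : ∫ x : E × E, Φ (x.1, x.2, x.1) ∂(m.prod m) =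
      (∫ x, F x * H x ∂m) * (∫ x, G x ∂m) := by
    rw [← integral_prod_mul]
    exact integral_congr_ae (ae_of_all _ fun x => by simp [hΦ]; ring)
  have e3 : ∫ x : E × E, Φ (x.2, x.1, x.1) ∂(m.prod m) =
      (∫ x, G x * H x ∂m) * (∫ x, F x ∂m) := by
    rw [← integral_prod_mul]
    exact integral_congr_ae (ae_of_all _ fun x => by simp [hΦ]; ring)
  have e4 : ∫ x : E, Φ (x, x, x) ∂m = ∫ x, F x * G x * H x ∂m :=
    integral_congr_ae (ae_of_all _ fun x => by simp [hΦ]; ring)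
  rw [e0, e1, e2, e3, e4] at hval
  rw [← hmap] at hK hval
  have hI : Integrable (fun q : Ω × ℕ × ℕ × ℕ => Φ (V q.2.1 q.1, V q.2.2.1 q.1, V q.2.2.2 q.1))
      (μ.prod Measure.count) := (integrable_map_measure hK.1 hm.aemeasurable).1 hK
  have hpt : ∀ ω, ∫ p, Φ (V p.1 ω, V p.2.1 ω, V p.2.2 ω)
        ∂(Measure.count : Measure (ℕ × ℕ × ℕ)) =
      (∫ i, F (V i ω) ∂Measure.count) * (∫ i, G (V i ω) ∂Measure.count)
        * ∫ i, H (V i ω) ∂Measure.count := fun ω => by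
    rw [hΦ, count_prod_count, count_prod_count, integral_prod_mul (fun i => F (V i ω))
      (fun q : ℕ × ℕ => G (V q.1 ω) * H (V q.2 ω)),
      integral_prod_mul (fun i => G (V i ω)) (fun i => H (V i ω)), mul_assoc]
  have h1 := hI.integral_prod_left
  rw [integral_map hm.aemeasurable hK.1, integral_prod _ hI] at hval
  simp only [hpt] at h1 hval
  exact ⟨h1, hval⟩

end PoissonMoments

end PoissonCluster

namespace PoissonCluster

/-! ### First three moments of the Poisson distribution -/

section PoissonLaw

theorem lintegral_poissonMeasure_eq_tsum (r : ℝ≥0) (g : ℕ → ℝ≥0∞) :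
    ∫⁻ n, g n ∂(poissonMeasure r) = ∑' n, g n * poissonMeasure r {n} := by
  rw [lintegral_countable']

theorem poissonMeasure_singleton_succ (r : ℝ≥0) (n : ℕ) :
    ((n + 1 : ℕ) : ℝ≥0∞) * poissonMeasure r {n + 1} = r * poissonMeasure r {n} := by
  rw [poissonMeasure_singleton, poissonMeasure_singleton, ← ENNReal.ofReal_natCast,
    ← ENNReal.ofReal_coe_nnreal, ← ENNReal.ofReal_mul (by positivity),
    ← ENNReal.ofReal_mul (by positivity)]
  congr 1
  rw [Nat.factorial_succ]
  push_cast
  field_simp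
  ring

/-- The Stein–Chen identity `E[n g(n)] = r E[g(n + 1)]`, from the recursion for the Poisson weights.
Each use lowers the degree of a moment by one. -/
theorem lintegral_mul_poissonMeasure (r : ℝ≥0) (g : ℕ → ℝ≥0∞) :
    ∫⁻ n, (n : ℝ≥0∞) * g n ∂(poissonMeasure r) = r * ∫⁻ n, g (n + 1) ∂(poissonMeasure r) := by
  rw [lintegral_poissonMeasure_eq_tsum, lintegral_poissonMeasure_eq_tsum,
    tsum_eq_zero_add' ENNReal.summable, ← ENNReal.tsum_mul_left]
  simp only [Nat.cast_zero, zero_mul, zero_add]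
  refine tsum_congr fun n => ?_
  rw [mul_right_comm, poissonMeasure_singleton_succ]
  ring

theorem lintegral_id_poissonMeasure (r : ℝ≥0) :
    ∫⁻ n, (n : ℝ≥0∞) ∂(poissonMeasure r) = r := by
  simpa using lintegral_mul_poissonMeasure r (fun _ => 1)

theorem lintegral_sq_poissonMeasure (r : ℝ≥0) :
    ∫⁻ n, (n : ℝ≥0∞) * n ∂(poissonMeasure r) = r * r + r := by
  rw [lintegral_mul_poissonMeasure]
  push_cast
  rw [lintegral_add_left (by fun_prop), lintegral_id_poissonMeasure]
  simp [mul_add]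

/-- The three copies of `r * r` stay separate so as to match the three pair terms of
`lintegral_tsum_mul_mul`. -/
theorem lintegral_cube_poissonMeasure (r : ℝ≥0) :
    ∫⁻ n, (n : ℝ≥0∞) * (n * n) ∂(poissonMeasure r) =
      r * (r * r) + r * r + r * r + r * r + r := by
  rw [lintegral_mul_poissonMeasure]
  have h : ∀ n : ℕ, ((n + 1 : ℕ) : ℝ≥0∞) * ((n + 1 : ℕ) : ℝ≥0∞) = n * n + (n + (n + 1)) := by
    intro n; push_cast; ring
  simp only [h]
  rw [lintegral_add_left (by fun_prop), lintegral_add_left (by fun_prop),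
    lintegral_add_left (by fun_prop), lintegral_id_poissonMeasure, lintegral_sq_poissonMeasure]
  simp
  ring

end PoissonLaw

/-! ### Recognizing product measures from equal or disjoint sides -/

section Partition

variable {E : Type*} [MeasurableSpace E] {m : Measure E}

theorem exists_common_partition {A B C : Set E} (hA : MeasurableSet A) (hB : MeasurableSet B)
    (hC : MeasurableSet C) (mA : m A ≠ ∞) (mB : m B ≠ ∞) (mC : m C ≠ ∞) :
    ∃ (Q : Bool × Bool × Bool → Set E) (I J K : Finset (Bool × Bool × Bool)),
      (∀ q, MeasurableSet (Q q)) ∧ (∀ q, m (Q q) ≠ ∞) ∧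
      (Pairwise fun p q => Disjoint (Q p) (Q q)) ∧
      A = ⋃ q ∈ I, Q q ∧ B = ⋃ q ∈ J, Q q ∧ C = ⋃ q ∈ K, Q q := by
  classical
  set φ : E → Bool × Bool × Bool := fun x => (decide (x ∈ A), decide (x ∈ B), decide (x ∈ C))
    with hφ
  have hdec : ∀ {S : Set E}, MeasurableSet S → Measurable fun x => decide (x ∈ S) := by
    intro S hS
    refine measurable_to_bool ?_
    convert hS using 1
    ext x; simp
  have hφm : Measurable φ := (hdec hA).prodMk ((hdec hB).prodMk (hdec hC))
  -- Cells are indexed by membership in `A`, `B`, `C`. Intersecting with the union makes every cell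
  -- of finite measure; the all-`false` cell becomes empty.
  refine ⟨fun q => (A ∪ B ∪ C) ∩ φ ⁻¹' {q}, Finset.univ.filter fun q => q.1 = true,
    Finset.univ.filter fun q => q.2.1 = true, Finset.univ.filter fun q => q.2.2 = true,
    fun q => ((hA.union hB).union hC).inter (hφm (measurableSet_singleton q)), fun q => ?_,
    fun p q hpq => ?_, ?_, ?_, ?_⟩
  · refine ne_top_of_le_ne_top ?_ (measure_mono inter_subset_left)
    exact (measure_union_lt_top (measure_union_lt_top mA.lt_top mB.lt_top) mC.lt_top).ne
  · refine Set.disjoint_left.2 ?_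
    rintro x ⟨-, hx⟩ ⟨-, hx'⟩
    exact hpq (hx.symm.trans hx')
  all_goals
    ext x
    simp only [hφ, Finset.mem_filter, Finset.mem_univ, true_and, mem_iUnion, mem_inter_iff,
      mem_union, mem_preimage, mem_singleton_iff, exists_prop]
    constructor
    · intro hx
      exact ⟨_, by simpa using hx, by tauto, rfl⟩
    · rintro ⟨q, hq, -, rfl⟩
      simpa using hq

theorem generateFrom_finite_measure [SigmaFinite m] :
    MeasurableSpace.generateFrom {s : Set E | MeasurableSet s ∧ m s ≠ ∞} = ‹MeasurableSpace E› := by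
  refine le_antisymm (MeasurableSpace.generateFrom_le fun s hs => hs.1) fun s hs => ?_
  have : s = ⋃ n, s ∩ spanningSets m n := by rw [← inter_iUnion, iUnion_spanningSets, inter_univ]
  rw [this]
  refine MeasurableSet.iUnion fun n => MeasurableSpace.measurableSet_generateFrom
    ⟨hs.inter (measurableSet_spanningSets m n), ?_⟩
  exact ne_top_of_le_ne_top (measure_spanningSets_lt_top m n).ne (measure_mono inter_subset_right)

theorem isPiSystem_finite_measure : IsPiSystem {s : Set E | MeasurableSet s ∧ m s ≠ ∞} :=
  fun _ hs _ ht _ => ⟨hs.1.inter ht.1,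
    ne_top_of_le_ne_top hs.2 (measure_mono inter_subset_left)⟩

/-- The spanning sets of a `σ`-finite measure, as measurable sets of finite measure. -/
noncomputable def finiteMeasureSpanning (m : Measure E) [SigmaFinite m] :
    m.FiniteSpanningSetsIn {s : Set E | MeasurableSet s ∧ m s ≠ ∞} where
  set := spanningSets m
  set_mem n := ⟨measurableSet_spanningSets m n, (measure_spanningSets_lt_top m n).ne⟩
  finite := measure_spanningSets_lt_top m
  spanning := iUnion_spanningSets m

theorem biUnion_prod_biUnion {E F ι κ : Type*} {Q : ι → Set E} {R : κ → Set F} (I : Finset ι)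
    (J : Finset κ) :
    (⋃ q ∈ I, Q q) ×ˢ (⋃ q ∈ J, R q) = ⋃ r ∈ I ×ˢ J, Q r.1 ×ˢ R r.2 := by
  ext x
  simp only [mem_prod, mem_iUnion, Finset.mem_product, exists_prop]
  constructor
  · rintro ⟨⟨p, hp, hxp⟩, q, hq, hxq⟩
    exact ⟨(p, q), ⟨hp, hq⟩, hxp, hxq⟩
  · rintro ⟨r, ⟨hp, hq⟩, hxp, hxq⟩
    exact ⟨⟨r.1, hp, hxp⟩, r.2, hq, hxq⟩

theorem measure_biUnion_prod {F : Type*} [MeasurableSpace F] {ι κ : Type*} (M : Measure (E × F))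
    {Q : ι → Set E} {R : κ → Set F} (I : Finset ι) (J : Finset κ) (hQ : ∀ i, MeasurableSet (Q i))
    (hR : ∀ i, MeasurableSet (R i)) (dQ : Pairwise fun p q => Disjoint (Q p) (Q q))
    (dR : Pairwise fun p q => Disjoint (R p) (R q)) :
    M ((⋃ q ∈ I, Q q) ×ˢ (⋃ q ∈ J, R q)) = ∑ p ∈ I, ∑ q ∈ J, M (Q p ×ˢ R q) := by
  rw [← Finset.sum_product', ← measure_biUnion_finset]
  · rw [biUnion_prod_biUnion]
  · intro p _ q _ hpq
    by_cases h : p.1 = q.1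
    · exact Disjoint.set_prod_right (dR fun h' => hpq (Prod.ext h h')) _ _
    · exact Disjoint.set_prod_left (dQ h) _ _
  · exact fun p _ => (hQ _).prod (hR _)

/-- The Poisson axioms give moments only for a single set or for disjoint sets. Arbitrary sides are
cut along a common partition, whose cells are equal or disjoint, and both measures are additive over
the cells. -/
theorem prod_eq_of_equal_or_disjoint [SigmaFinite m] {M : Measure (E × E)}
    (h : ∀ A B : Set E, MeasurableSet A → MeasurableSet B → m A ≠ ∞ → m B ≠ ∞ →
      (A = B ∨ Disjoint A B) → M (A ×ˢ B) = m A * m B) : M = m.prod m := by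
  refine (Measure.prod_eq_generateFrom generateFrom_finite_measure generateFrom_finite_measure
    isPiSystem_finite_measure isPiSystem_finite_measure (finiteMeasureSpanning m)
    (finiteMeasureSpanning m) ?_).symm
  rintro A ⟨hA, mA⟩ B ⟨hB, mB⟩
  obtain ⟨Q, I, J, -, hQ, mQ, dQ, rfl, rfl, -⟩ :=
    exists_common_partition hA hB MeasurableSet.empty mA mB (by simp)
  rw [measure_biUnion_prod M I J hQ hQ dQ dQ,
    measure_biUnion_finset (fun p _ q _ hpq => dQ hpq) (fun p _ => hQ p),
    measure_biUnion_finset (fun p _ q _ hpq => dQ hpq) (fun p _ => hQ p), Finset.sum_mul_sum]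
  refine Finset.sum_congr rfl fun p _ => Finset.sum_congr rfl fun q _ => ?_
  refine h _ _ (hQ p) (hQ q) (mQ p) (mQ q) ?_
  by_cases hpq : p = q
  · exact Or.inl (by rw [hpq])
  · exact Or.inr (dQ hpq)

theorem prod_prod_eq_of_equal_or_disjoint [SigmaFinite m] {M : Measure (E × E × E)}
    (h : ∀ A B C : Set E, MeasurableSet A → MeasurableSet B → MeasurableSet C →
      m A ≠ ∞ → m B ≠ ∞ → m C ≠ ∞ → (A = B ∨ Disjoint A B) → (A = C ∨ Disjoint A C) →
      (B = C ∨ Disjoint B C) → M (A ×ˢ B ×ˢ C) = m A * (m B * m C)) :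
    M = m.prod (m.prod m) := by
  refine (Measure.prod_eq_generateFrom generateFrom_finite_measure
    (generateFrom_eq_prod generateFrom_finite_measure generateFrom_finite_measure
      (finiteMeasureSpanning m).isCountablySpanning (finiteMeasureSpanning m).isCountablySpanning)
    isPiSystem_finite_measure (isPiSystem_finite_measure.prod isPiSystem_finite_measure)
    (finiteMeasureSpanning m) ((finiteMeasureSpanning m).prod (finiteMeasureSpanning m)) ?_).symm
  rintro A ⟨hA, mA⟩ _ ⟨B, ⟨hB, mB⟩, C, ⟨hC, mC⟩, rfl⟩
  rw [Measure.prod_prod]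
  obtain ⟨Q, I, J, K, hQ, mQ, dQ, rfl, rfl, rfl⟩ := exists_common_partition hA hB hC mA mB mC
  change M ((⋃ q ∈ I, Q q) ×ˢ ((⋃ q ∈ J, Q q) ×ˢ (⋃ q ∈ K, Q q))) = _
  rw [biUnion_prod_biUnion J K, measure_biUnion_prod M I (J ×ˢ K) hQ (fun r => (hQ r.1).prod (hQ r.2)) dQ
    (R := fun r => Q r.1 ×ˢ Q r.2),
    measure_biUnion_finset (s := I) (fun p _ q _ hpq => dQ hpq) (fun p _ => hQ p),
    measure_biUnion_finset (s := J) (fun p _ q _ hpq => dQ hpq) (fun p _ => hQ p),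
    measure_biUnion_finset (s := K) (fun p _ q _ hpq => dQ hpq) (fun p _ => hQ p),
    (Finset.sum_mul_sum J K (fun q => m (Q q)) (fun q => m (Q q))).trans
      (Finset.sum_product' J K fun p q => m (Q p) * m (Q q)).symm, Finset.sum_mul_sum]
  · have eq_or : ∀ p q, Q p = Q q ∨ Disjoint (Q p) (Q q) := fun p q => by
      by_cases hpq : p = q
      · exact Or.inl (by rw [hpq])
      · exact Or.inr (dQ hpq)
    exact Finset.sum_congr rfl fun p _ => Finset.sum_congr rfl fun q _ =>
      h _ _ _ (hQ _) (hQ _) (hQ _) (mQ _) (mQ _) (mQ _) (eq_or _ _) (eq_or _ _) (eq_or _ _)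
  · intro p q hpq
    by_cases h : p.1 = q.1
    · exact Disjoint.set_prod_right (dQ fun h' => hpq (Prod.ext h h')) _ _
    · exact Disjoint.set_prod_left (dQ h) _ _

end Partition

/-! ### Factorial moment measures of the homogeneous Poisson process -/

section Homogeneous

variable {Ω : Type*}

/-- The number of points `U j` in `A`. -/
noncomputable def pointCount (U : ℕ → Ω → ℝ) (A : Set ℝ) (ω : Ω) : ℝ≥0∞ :=
  ∑' j, A.indicator 1 (U j ω)

theorem sum_dirac_apply (U : ℕ → Ω → ℝ) {A : Set ℝ} (hA : MeasurableSet A) (ω : Ω) :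
    (Measure.sum fun j => Measure.dirac (U j ω)) A = pointCount U A ω := by
  rw [Measure.sum_apply _ hA, pointCount]
  exact tsum_congr fun j => Measure.dirac_apply' _ hA

variable [MeasurableSpace Ω] {U : ℕ → Ω → ℝ} {ν : ℝ≥0} {μ : Measure Ω}

theorem measurable_pointCount (hU : ∀ j, Measurable (U j)) {A : Set ℝ} (hA : MeasurableSet A) :
    Measurable (pointCount U A) :=
  Measurable.tsum fun j => (measurable_one.indicator hA).comp (hU j)

theorem lintegral_mul_of_indepFun {X Y : Ω → ℝ≥0∞} (hX : Measurable X) (hY : Measurable Y)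
    (h : IndepFun X Y μ) : ∫⁻ ω, X ω * Y ω ∂μ = (∫⁻ ω, X ω ∂μ) * ∫⁻ ω, Y ω ∂μ :=
  lintegral_mul_eq_lintegral_mul_lintegral_of_indepFun hX hY h

namespace IsHomogeneousPoisson

variable (h : IsHomogeneousPoisson U ν μ)

include h

theorem lintegral_pointCount_comp {A : Set ℝ} (hA : MeasurableSet A) (mA : volume A ≠ ∞)
    {g : ℝ≥0∞ → ℝ≥0∞} (hg : Measurable g) :
    ∫⁻ ω, g (pointCount U A ω) ∂μ =
      ∫⁻ n : ℕ, g n ∂(poissonMeasure (ν * (volume A).toNNReal)) := by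
  have h1 := congrArg (fun P => ∫⁻ x, g x ∂P) (h.law A hA mA)
  simp only [sum_dirac_apply U hA] at h1
  rwa [lintegral_map hg (measurable_pointCount h.measurable hA),
    lintegral_map hg (by fun_prop)] at h1

omit h in
theorem coe_rate_mul {A : Set ℝ} (mA : volume A ≠ ∞) :
    ((ν * (volume A).toNNReal : ℝ≥0) : ℝ≥0∞) = (ν • volume : Measure ℝ) A := by
  rw [ENNReal.coe_mul, ENNReal.coe_toNNReal mA]
  rfl

theorem lintegral_pointCount {A : Set ℝ} (hA : MeasurableSet A) (mA : volume A ≠ ∞) :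
    ∫⁻ ω, pointCount U A ω ∂μ = (ν • volume : Measure ℝ) A := by
  rw [h.lintegral_pointCount_comp hA mA (g := fun x => x) measurable_id, ← coe_rate_mul mA]
  exact lintegral_id_poissonMeasure _

theorem lintegral_pointCount_sq {A : Set ℝ} (hA : MeasurableSet A) (mA : volume A ≠ ∞) :
    ∫⁻ ω, pointCount U A ω * pointCount U A ω ∂μ =
      (ν • volume : Measure ℝ) A * (ν • volume : Measure ℝ) A + (ν • volume : Measure ℝ) A := by
  rw [h.lintegral_pointCount_comp hA mA (g := fun x => x * x) (by fun_prop), ← coe_rate_mul mA]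
  exact lintegral_sq_poissonMeasure _

theorem lintegral_pointCount_cube {A : Set ℝ} (hA : MeasurableSet A) (mA : volume A ≠ ∞) :
    ∫⁻ ω, pointCount U A ω * (pointCount U A ω * pointCount U A ω) ∂μ =
      (ν • volume : Measure ℝ) A * ((ν • volume : Measure ℝ) A * (ν • volume : Measure ℝ) A)
      + (ν • volume : Measure ℝ) A * (ν • volume : Measure ℝ) A
      + (ν • volume : Measure ℝ) A * (ν • volume : Measure ℝ) A
      + (ν • volume : Measure ℝ) A * (ν • volume : Measure ℝ) A + (ν • volume : Measure ℝ) A := by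
  rw [h.lintegral_pointCount_comp hA mA (g := fun x => x * (x * x)) (by fun_prop),
    ← coe_rate_mul mA]
  exact lintegral_cube_poissonMeasure _

theorem indepFun_pointCount {A B : Set ℝ} (hA : MeasurableSet A) (hB : MeasurableSet B)
    (mA : volume A ≠ ∞) (mB : volume B ≠ ∞) (hAB : Disjoint A B) :
    IndepFun (pointCount U A) (pointCount U B) μ := by
  have hi := h.indep 2 ![A, B] (by intro i; fin_cases i <;> assumption)
    (by intro i; fin_cases i <;> assumption)
    (by intro i j hij; fin_cases i <;> fin_cases j <;> simp_all [disjoint_comm])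
  have := hi.indepFun (show (0 : Fin 2) ≠ 1 by decide)
  simpa [sum_dirac_apply U hA, sum_dirac_apply U hB] using this

theorem lintegral_pointCount_mul {A B : Set ℝ} (hA : MeasurableSet A) (hB : MeasurableSet B)
    (mA : volume A ≠ ∞) (mB : volume B ≠ ∞) (hAB : Disjoint A B) :
    ∫⁻ ω, pointCount U A ω * pointCount U B ω ∂μ =
      (ν • volume : Measure ℝ) A * (ν • volume : Measure ℝ) B := by
  rw [lintegral_mul_of_indepFun (measurable_pointCount h.measurable hA)
    (measurable_pointCount h.measurable hB) (h.indepFun_pointCount hA hB mA mB hAB),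
    h.lintegral_pointCount hA mA, h.lintegral_pointCount hB mB]

theorem lintegral_pointCount_sq_mul {A B : Set ℝ} (hA : MeasurableSet A) (hB : MeasurableSet B)
    (mA : volume A ≠ ∞) (mB : volume B ≠ ∞) (hAB : Disjoint A B) :
    ∫⁻ ω, (pointCount U A ω * pointCount U A ω) * pointCount U B ω ∂μ =
      ((ν • volume : Measure ℝ) A * (ν • volume : Measure ℝ) A + (ν • volume : Measure ℝ) A)
        * (ν • volume : Measure ℝ) B := by
  have hA' := measurable_pointCount h.measurable hA
  rw [lintegral_mul_of_indepFun (X := fun ω => pointCount U A ω * pointCount U A ω) (hA'.mul hA')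
    (measurable_pointCount h.measurable hB)
    ((h.indepFun_pointCount hA hB mA mB hAB).comp (φ := fun x => x * x) (ψ := id)
      (by fun_prop) measurable_id),
    h.lintegral_pointCount_sq hA mA, h.lintegral_pointCount hB mB]

theorem lintegral_pointCount_mul_mul {A B C : Set ℝ} (hA : MeasurableSet A)
    (hB : MeasurableSet B) (hC : MeasurableSet C) (mA : volume A ≠ ∞) (mB : volume B ≠ ∞)
    (mC : volume C ≠ ∞) (hAB : Disjoint A B) (hAC : Disjoint A C) (hBC : Disjoint B C) :
    ∫⁻ ω, (pointCount U A ω * pointCount U B ω) * pointCount U C ω ∂μ =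
      ((ν • volume : Measure ℝ) A * (ν • volume : Measure ℝ) B) * (ν • volume : Measure ℝ) C := by
  have hA' := measurable_pointCount h.measurable hA
  have hB' := measurable_pointCount h.measurable hB
  have hC' := measurable_pointCount h.measurable hC
  have hi := h.indep 3 ![A, B, C] (by intro i; fin_cases i <;> assumption)
    (by intro i; fin_cases i <;> assumption)
    (by intro i j hij; fin_cases i <;> fin_cases j <;> simp_all [disjoint_comm])
  have hm : ∀ i : Fin 3, Measurable fun ω =>
      (Measure.sum fun j => Measure.dirac (U j ω)) (![A, B, C] i) := by
    intro i
    fin_cases i <;> simp [sum_dirac_apply U hA, sum_dirac_apply U hB, sum_dirac_apply U hC] <;>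
      assumption
  have hp := (hi.indepFun_prodMk hm 0 1 2 (by decide) (by decide)).comp
    (φ := fun x : ℝ≥0∞ × ℝ≥0∞ => x.1 * x.2) (ψ := id) (by fun_prop) measurable_id
  have hp' : IndepFun (fun ω => pointCount U A ω * pointCount U B ω) (pointCount U C) μ := by
    simpa [Function.comp_def, sum_dirac_apply U hA, sum_dirac_apply U hB, sum_dirac_apply U hC]
      using hp
  rw [lintegral_mul_of_indepFun (X := fun ω => pointCount U A ω * pointCount U B ω) (hA'.mul hB') hC' hp', h.lintegral_pointCount_mul hA hB mA mB hAB,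
    h.lintegral_pointCount hC mC]

-- The generating sets have finite `ν • volume`, whereas the Poisson axioms require finite length.
-- Positivity of `ν` bridges the two, since `0 * ∞ = 0` in `ℝ≥0∞`.
omit h in
theorem volume_ne_top_of_smul (hν : 0 < ν) {A : Set ℝ} (mA : (ν • volume : Measure ℝ) A ≠ ∞) :
    volume A ≠ ∞ := by
  intro hA
  apply mA
  rw [Measure.smul_apply, hA, ENNReal.smul_def, smul_eq_mul, ENNReal.mul_top (by simpa using hν.ne')]

theorem intensityMeasure_eq (hν : 0 < ν) : intensityMeasure U μ = ν • volume := by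
  refine ((finiteMeasureSpanning (ν • volume : Measure ℝ)).ext generateFrom_finite_measure.symm
    isPiSystem_finite_measure ?_).symm
  rintro A ⟨hA, mA⟩
  rw [← h.lintegral_pointCount hA (volume_ne_top_of_smul hν mA)]
  have := lintegral_tsum_points (μ := μ) h.measurable (F := A.indicator 1)
    (measurable_one.indicator hA)
  rw [lintegral_indicator_one hA] at this
  exact this

omit h in
theorem lintegral_indicator_mul {E F : Type*} [MeasurableSpace E] [MeasurableSpace F]
    (M : Measure (E × F)) {A : Set E} {B : Set F} (hA : MeasurableSet A) (hB : MeasurableSet B) :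
    ∫⁻ x, A.indicator (1 : E → ℝ≥0∞) x.1 * B.indicator (1 : F → ℝ≥0∞) x.2 ∂M = M (A ×ˢ B) := by
  rw [← lintegral_indicator_one (hA.prod hB)]
  refine lintegral_congr fun x => ?_
  by_cases h1 : x.1 ∈ A <;> by_cases h2 : x.2 ∈ B <;> simp [h1, h2, Set.indicator]

/-- The full second moment of the counts is the pair measure of `A ×ˢ B` plus the intensity of `A ∩
B`. For `A = B` the Poisson value `r * r + r` contains the same diagonal term, finite and hence
cancellable in `ℝ≥0∞`; for disjoint sets the diagonal term vanishes. -/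
theorem pairMeasure_eq [SFinite μ] (hν : 0 < ν) :
    pairMeasure U μ = (ν • volume : Measure ℝ).prod (ν • volume) := by
  refine prod_eq_of_equal_or_disjoint ?_
  intro A B hA hB mA' mB' hAB
  have mA := volume_ne_top_of_smul hν mA'
  have mB := volume_ne_top_of_smul hν mB'
  have key := lintegral_tsum_mul (μ := μ) h.measurable (F := A.indicator 1) (G := B.indicator 1)
    (measurable_one.indicator hA) (measurable_one.indicator hB)
  rw [lintegral_indicator_mul _ hA hB, h.intensityMeasure_eq hν] at key
  simp only [← inter_indicator_mul, Pi.one_apply, mul_one] at key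
  rw [lintegral_indicator_const (hA.inter hB), one_mul] at key
  change ∫⁻ ω, pointCount U A ω * pointCount U B ω ∂μ = _ at key
  rcases hAB with rfl | hAB
  · rw [h.lintegral_pointCount_sq hA mA, inter_self] at key
    exact ((ENNReal.add_left_inj mA').1 key).symm
  · rw [h.lintegral_pointCount_mul hA hB mA mB hAB, hAB.inter_eq, measure_empty, add_zero] at key
    exact key.symm

theorem tripleMeasure_eq [SFinite μ] (hν : 0 < ν) :
    tripleMeasure U μ = (ν • volume : Measure ℝ).prod ((ν • volume : Measure ℝ).prod (ν • volume)) := by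
  refine prod_prod_eq_of_equal_or_disjoint ?_
  intro A B C hA hB hC mA' mB' mC' hAB hAC hBC
  have mA := volume_ne_top_of_smul hν mA'
  have mB := volume_ne_top_of_smul hν mB'
  have mC := volume_ne_top_of_smul hν mC'
  have key := lintegral_tsum_mul_mul (μ := μ) h.measurable (F := A.indicator 1)
    (G := B.indicator 1) (H := C.indicator 1)
    (measurable_one.indicator hA) (measurable_one.indicator hB) (measurable_one.indicator hC)
  have e0 : ∫⁻ x : ℝ × ℝ × ℝ, A.indicator (1 : ℝ → ℝ≥0∞) x.1 * (B.indicator (1 : ℝ → ℝ≥0∞) x.2.1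
      * C.indicator (1 : ℝ → ℝ≥0∞) x.2.2) ∂(tripleMeasure U μ) = tripleMeasure U μ (A ×ˢ B ×ˢ C) := by
    rw [← lintegral_indicator_mul _ hA (hB.prod hC)]
    refine lintegral_congr fun x => ?_
    congr 1
    by_cases h1 : x.2.1 ∈ B <;> by_cases h2 : x.2.2 ∈ C <;> simp [h1, h2, Set.indicator]
  have pr : ∀ {S T R : Set ℝ} (x y : ℝ), S.indicator (1 : ℝ → ℝ≥0∞) x *
      (T.indicator (1 : ℝ → ℝ≥0∞) x * R.indicator (1 : ℝ → ℝ≥0∞) y) =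
      (S ∩ T).indicator (1 : ℝ → ℝ≥0∞) x * R.indicator (1 : ℝ → ℝ≥0∞) y := by
    intro S T R x y
    by_cases h1 : x ∈ S <;> by_cases h2 : x ∈ T <;> simp [h1, h2, Set.indicator]
  have e1 : ∫⁻ x : ℝ × ℝ, A.indicator (1 : ℝ → ℝ≥0∞) x.1 * (B.indicator (1 : ℝ → ℝ≥0∞) x.1
      * C.indicator (1 : ℝ → ℝ≥0∞) x.2) ∂(pairMeasure U μ) =
      (ν • volume : Measure ℝ) (A ∩ B) * (ν • volume : Measure ℝ) C := by
    simp only [pr]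
    rw [lintegral_indicator_mul _ (hA.inter hB) hC, h.pairMeasure_eq hν, Measure.prod_prod]
  have e2 : ∫⁻ x : ℝ × ℝ, A.indicator (1 : ℝ → ℝ≥0∞) x.1 * (B.indicator (1 : ℝ → ℝ≥0∞) x.2
      * C.indicator (1 : ℝ → ℝ≥0∞) x.1) ∂(pairMeasure U μ) =
      (ν • volume : Measure ℝ) (A ∩ C) * (ν • volume : Measure ℝ) B := by
    simp only [mul_comm (B.indicator _ _), pr]
    rw [lintegral_indicator_mul _ (hA.inter hC) hB, h.pairMeasure_eq hν, Measure.prod_prod]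
  have e3 : ∫⁻ x : ℝ × ℝ, A.indicator (1 : ℝ → ℝ≥0∞) x.2 * (B.indicator (1 : ℝ → ℝ≥0∞) x.1
      * C.indicator (1 : ℝ → ℝ≥0∞) x.1) ∂(pairMeasure U μ) =
      (ν • volume : Measure ℝ) (B ∩ C) * (ν • volume : Measure ℝ) A := by
    simp only [mul_comm (A.indicator _ _), mul_assoc, pr]
    rw [lintegral_indicator_mul _ (hB.inter hC) hA, h.pairMeasure_eq hν, Measure.prod_prod]
  have e4 : ∫⁻ x : ℝ, A.indicator (1 : ℝ → ℝ≥0∞) x * (B.indicator (1 : ℝ → ℝ≥0∞) x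
      * C.indicator (1 : ℝ → ℝ≥0∞) x) ∂(intensityMeasure U μ) =
      (ν • volume : Measure ℝ) (A ∩ B ∩ C) := by
    rw [h.intensityMeasure_eq hν, ← lintegral_indicator_one ((hA.inter hB).inter hC)]
    refine lintegral_congr fun x => ?_
    rw [pr, ← inter_indicator_mul]
    simp [Set.indicator]
  rw [e0, e1, e2, e3, e4] at key
  change ∫⁻ ω, pointCount U A ω * (pointCount U B ω * pointCount U C ω) ∂μ = _ at key
  -- Five configurations: all three sets equal, two equal and disjoint from the other (three ways),
  -- all disjoint. The surviving diagonal terms of `key` also occur in the Poisson moment and are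
  -- cancelled, being finite.
  rcases hAB with rfl | hAB
  · rcases hAC with rfl | hAC
    · rw [h.lintegral_pointCount_cube hA mA] at key
      simp only [inter_self] at key
      have fin : (ν • volume : Measure ℝ) A * (ν • volume : Measure ℝ) A ≠ ∞ :=
        ENNReal.mul_ne_top mA' mA'
      rw [ENNReal.add_left_inj mA', ENNReal.add_left_inj fin, ENNReal.add_left_inj fin,
        ENNReal.add_left_inj fin] at key
      exact key.symm
    · simp only [← mul_assoc] at key
      rw [h.lintegral_pointCount_sq_mul hA hC mA mC hAC] at key
      simp only [inter_self, hAC.inter_eq, measure_empty, zero_mul, add_zero, add_mul] at key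
      rw [ENNReal.add_left_inj (ENNReal.mul_ne_top mA' mC')] at key
      rw [← key, mul_assoc]
  · rcases hAC with rfl | hAC
    · simp only [mul_comm (pointCount U B _), ← mul_assoc] at key
      rw [h.lintegral_pointCount_sq_mul hA hB mA mB hAB] at key
      simp only [inter_self, hAB.inter_eq, hAB.symm.inter_eq, empty_inter, measure_empty, zero_mul,
        add_zero, add_mul] at key
      rw [ENNReal.add_left_inj (ENNReal.mul_ne_top mA' mB')] at key
      rw [← key]
      ring
    · rcases hBC with rfl | hBC
      · simp only [mul_comm (pointCount U A _)] at key
        rw [h.lintegral_pointCount_sq_mul hB hA mB mA hAB.symm] at key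
        simp only [inter_self, hAB.inter_eq, empty_inter, measure_empty, zero_mul,
          add_zero, add_mul] at key
        rw [ENNReal.add_left_inj (ENNReal.mul_ne_top mB' mA')] at key
        rw [← key]
        ring
      · simp only [← mul_assoc] at key
        rw [h.lintegral_pointCount_mul_mul hA hB hC mA mB mC hAB hAC hBC] at key
        simp only [hAB.inter_eq, hAC.inter_eq, hBC.inter_eq, empty_inter, measure_empty, zero_mul,
          add_zero] at key
        rw [← key]
        ring

end IsHomogeneousPoisson

end Homogeneous

end PoissonCluster

namespace PoissonCluster

/-! ### Independent marking -/

section Marking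

/-- Independence of immigrants and clusters yields (pair of points) × (pair of marks); marking needs
the regrouping into a pair of marked points. -/
theorem map_shuffle_prod {α β γ δ : Type*} [MeasurableSpace α] [MeasurableSpace β]
    [MeasurableSpace γ] [MeasurableSpace δ] (a : Measure α) (b : Measure β) (c : Measure γ)
    (d : Measure δ) [SFinite a] [SFinite b] [SFinite c] [SFinite d] :
    ((a.prod b).prod (c.prod d)).map (fun x => ((x.1.1, x.2.1), (x.1.2, x.2.2))) =
      (a.prod c).prod (b.prod d) := by
  refine Measure.ext_of_lintegral _ fun f hf => ?_
  rw [lintegral_map hf (by fun_prop), lintegral_prod _ (by fun_prop),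
    lintegral_prod _ (by fun_prop), lintegral_prod _ (by fun_prop), lintegral_prod _ (by fun_prop)]
  refine lintegral_congr fun x => ?_
  have : ∀ y, ∫⁻ z : γ × δ, f ((x, z.1), (y, z.2)) ∂(c.prod d) =
      ∫⁻ z, ∫⁻ w, f ((x, z), (y, w)) ∂d ∂c := fun y => lintegral_prod _ (by fun_prop)
  simp only [this]
  rw [lintegral_lintegral_swap (by fun_prop)]
  refine lintegral_congr fun z => ?_
  rw [lintegral_prod _ (by fun_prop)]

theorem map_shuffle_prod_prod {α β γ α' β' γ' : Type*} [MeasurableSpace α] [MeasurableSpace β]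
    [MeasurableSpace γ] [MeasurableSpace α'] [MeasurableSpace β'] [MeasurableSpace γ']
    (a : Measure α) (b : Measure β) (c : Measure γ) (a' : Measure α') (b' : Measure β')
    (c' : Measure γ') [SFinite a] [SFinite b] [SFinite c] [SFinite a'] [SFinite b'] [SFinite c'] :
    ((a.prod (b.prod c)).prod (a'.prod (b'.prod c'))).map
        (fun x => ((x.1.1, x.2.1), (x.1.2.1, x.2.2.1), (x.1.2.2, x.2.2.2))) =
      (a.prod a').prod ((b.prod b').prod (c.prod c')) := by
  rw [← map_shuffle_prod b c b' c']
  have h := Measure.map_prod_map (a.prod a') ((b.prod c).prod (b'.prod c'))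
    (f := id) (g := fun x => ((x.1.1, x.2.1), (x.1.2, x.2.2))) measurable_id (by fun_prop)
  rw [Measure.map_id] at h
  rw [h, ← map_shuffle_prod a (b.prod c) a' (b'.prod c'), Measure.map_map (by fun_prop) (by fun_prop)]
  rfl

variable {Ω α β : Type*} [MeasurableSpace Ω] [MeasurableSpace α] [MeasurableSpace β]

/-- Independent marking of a Poisson process. -/
theorem IsPoissonToOrderThree.marked {U : ℕ → Ω → α} {C : ℕ → Ω → β} {μ : Measure Ω}
    [IsProbabilityMeasure μ] {m : Measure α} [SFinite m] {L : Measure β} [IsProbabilityMeasure L]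
    (h : IsPoissonToOrderThree U μ m) (hC : ∀ j, Measurable (C j)) (hlaw : ∀ j, μ.map (C j) = L)
    (hi : iIndepFun C μ) (hind : IndepFun (fun ω j => U j ω) (fun ω j => C j ω) μ) :
    IsPoissonToOrderThree (fun j ω => (U j ω, C j ω)) μ (m.prod L) where
  measurable j := (h.measurable j).prodMk (hC j)
  intensity := by
    rw [intensityMeasure, ← h.intensity, intensityMeasure, Measure.prod_sum_left]
    congr 1
    funext j
    rw [← hlaw j]
    exact (hind.comp (φ := fun u : ℕ → α => u j) (ψ := fun c : ℕ → β => c j)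
      (by fun_prop) (by fun_prop)).map_prod_eq_prod_map_map
      (h.measurable j).aemeasurable (hC j).aemeasurable
  pair := by
    have hsh : Measurable fun x : (α × α) × (β × β) => ((x.1.1, x.2.1), (x.1.2, x.2.2)) := by
      fun_prop
    rw [← map_shuffle_prod m m L L, ← h.pair, pairMeasure, pairMeasure, Measure.prod_sum_left,
      Measure.map_sum hsh.aemeasurable]
    congr 1
    funext p
    split_ifs with hp
    · simp
    · have hU := (h.measurable p.1).prodMk (h.measurable p.2)
      have hCC := (hC p.1).prodMk (hC p.2)
      -- The pair measure contains only distinct indices, for which the two marks are independent.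
      have hL : μ.map (fun ω => (C p.1 ω, C p.2 ω)) = L.prod L := by
        rw [(hi.indepFun hp).map_prod_eq_prod_map_map (hC _).aemeasurable (hC _).aemeasurable,
          hlaw, hlaw]
      rw [← hL, ← (hind.comp (φ := fun u : ℕ → α => (u p.1, u p.2))
        (ψ := fun c : ℕ → β => (c p.1, c p.2)) (by fun_prop) (by fun_prop)).map_prod_eq_prod_map_map
        hU.aemeasurable hCC.aemeasurable, Measure.map_map hsh (hU.prodMk hCC)]
      rfl
  triple := by
    have hsh : Measurable fun x : (α × α × α) × (β × β × β) =>
        ((x.1.1, x.2.1), (x.1.2.1, x.2.2.1), (x.1.2.2, x.2.2.2)) := by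
      fun_prop
    rw [← map_shuffle_prod_prod m m m L L L, ← h.triple, tripleMeasure, tripleMeasure,
      Measure.prod_sum_left, Measure.map_sum hsh.aemeasurable]
    congr 1
    funext p
    split_ifs with hp
    · have hU := (h.measurable p.1).prodMk ((h.measurable p.2.1).prodMk (h.measurable p.2.2))
      have hCC := (hC p.2.1).prodMk (hC p.2.2)
      have hCCC := (hC p.1).prodMk hCC
      have hL : μ.map (fun ω => (C p.1 ω, C p.2.1 ω, C p.2.2 ω)) = L.prod (L.prod L) := by
        rw [(hi.indepFun_prodMk hC p.2.1 p.2.2 p.1 hp.1.symm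
            hp.2.1.symm).symm.map_prod_eq_prod_map_map (hC _).aemeasurable hCC.aemeasurable,
          (hi.indepFun hp.2.2).map_prod_eq_prod_map_map (hC _).aemeasurable (hC _).aemeasurable,
          hlaw, hlaw, hlaw]
      rw [← hL, ← (hind.comp (φ := fun u : ℕ → α => (u p.1, u p.2.1, u p.2.2))
        (ψ := fun c : ℕ → β => (c p.1, c p.2.1, c p.2.2)) (by fun_prop)
        (by fun_prop)).map_prod_eq_prod_map_map
        hU.aemeasurable hCCC.aemeasurable, Measure.map_map hsh (hU.prodMk hCCC)]
      rfl
    · simp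

theorem IsPoissonClusterSystem.isPoissonToOrderThree {Ω₀ : Type*} [MeasurableSpace Ω₀]
    {U : ℕ → Ω → ℝ} {C : ℕ → Ω → Measure ℝ} {ν : ℝ≥0} {μ : Measure Ω} [IsProbabilityMeasure μ]
    {C₀ : Ω₀ → Measure ℝ} {P : Measure Ω₀} [IsProbabilityMeasure P]
    (h : IsPoissonClusterSystem U C ν μ C₀ P) (hν : 0 < ν) :
    IsPoissonToOrderThree (fun j ω => (U j ω, C j ω)) μ ((ν • volume).prod (P.map C₀)) := by
  have : IsProbabilityMeasure (P.map C₀) :=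
    Measure.isProbabilityMeasure_map (h.identDistrib 0).aemeasurable_snd
  exact IsPoissonToOrderThree.marked ⟨h.poisson.measurable, h.poisson.intensityMeasure_eq hν,
    h.poisson.pairMeasure_eq hν, h.poisson.tripleMeasure_eq hν⟩ h.measurable_cluster
    (fun j => (h.identDistrib j).map_eq) h.indep_clusters h.indep_immigrants

end Marking

end PoissonCluster

namespace PoissonCluster

/-! ### Test functions -/

section TestFunctions

theorem IsTest.mul {f g : ℝ → ℝ} (hf : IsTest f) (hg : IsTest g) : IsTest fun x => f x * g x where
  measurable := hf.measurable.mul hg.measurable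
  bounded := by
    obtain ⟨b, hb⟩ := hf.bounded
    obtain ⟨c, hc⟩ := hg.bounded
    refine ⟨b * c, fun x => ?_⟩
    rw [abs_mul]
    exact mul_le_mul (hb x) (hc x) (abs_nonneg _) ((abs_nonneg _).trans (hb x))
  compact_support := hf.compact_support.mul_right

theorem IsTest.exists_bound {f : ℝ → ℝ} (hf : IsTest f) :
    ∃ (K : Set ℝ) (b : ℝ≥0), IsCompact K ∧ ∀ x, ‖f x‖ₑ ≤ K.indicator (fun _ => (b : ℝ≥0∞)) x := by
  obtain ⟨b, hb⟩ := hf.bounded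
  refine ⟨tsupport f, b.toNNReal, hf.compact_support, fun x => ?_⟩
  by_cases hx : x ∈ tsupport f
  · rw [indicator_of_mem hx, Real.enorm_eq_ofReal_abs]
    exact ENNReal.ofReal_le_ofReal (hb x)
  · simp [image_eq_zero_of_notMem_tsupport hx]

theorem IsTest.lintegral_enorm_le {f : ℝ → ℝ} (_hf : IsTest f) {K : Set ℝ} {b : ℝ≥0}
    (hK : IsCompact K) (hb : ∀ x, ‖f x‖ₑ ≤ K.indicator (fun _ => (b : ℝ≥0∞)) x) (ρ : Measure ℝ) :
    ∫⁻ x, ‖f x‖ₑ ∂ρ ≤ b * ρ K :=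
  (lintegral_mono hb).trans_eq (lintegral_indicator_const hK.measurableSet _)

theorem IsTest.integrable {f : ℝ → ℝ} (hf : IsTest f) (ρ : Measure ℝ)
    [IsFiniteMeasureOnCompacts ρ] : Integrable f ρ := by
  obtain ⟨K, b, hK, hb⟩ := hf.exists_bound
  exact ⟨hf.measurable.aestronglyMeasurable, (hf.lintegral_enorm_le hK hb ρ).trans_lt
    (ENNReal.mul_lt_top ENNReal.coe_lt_top hK.measure_lt_top)⟩

end TestFunctions

theorem integral_sub_sub_sub_add {α : Type*} [MeasurableSpace α] {μ : Measure α}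
    {a b c d e : α → ℝ} (ha : Integrable a μ) (hb : Integrable b μ) (hc : Integrable c μ)
    (hd : Integrable d μ) (he : Integrable e μ) :
    ∫ x, a x - b x - c x - d x + 2 * e x ∂μ =
      ∫ x, a x ∂μ - ∫ x, b x ∂μ - ∫ x, c x ∂μ - ∫ x, d x ∂μ + 2 * ∫ x, e x ∂μ := by
  have i2 : Integrable (fun x => a x - b x) μ := ha.sub hb
  have i3 : Integrable (fun x => a x - b x - c x) μ := i2.sub hc
  have i4 : Integrable (fun x => a x - b x - c x - d x) μ := i3.sub hd
  rw [integral_add i4 (he.const_mul 2), integral_sub i3 hd, integral_sub i2 hc, integral_sub ha hb,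
    integral_const_mul]

/-! ### Cumulants of Poisson superpositions of finite measures -/

section Superposition

variable {Ω E : Type*} [MeasurableSpace Ω] [MeasurableSpace E]

/-- A measurable family of finite measures on the line whose masses on compact sets have, under
`m`, moments up to order three. -/
structure HasCompactMoments (Q : E → Measure ℝ) (m : Measure E) : Prop where
  measurable : Measurable Q
  finite : ∀ e, IsFiniteMeasure (Q e)
  moment : ∀ K : Set ℝ, IsCompact K → ∀ p : ℕ, p ≠ 0 → p ≤ 3 → ∫⁻ e, (Q e K) ^ p ∂m < ∞

variable {Q : E → Measure ℝ} {m : Measure E}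

theorem measurable_integral_family (hQ : Measurable Q) {f : ℝ → ℝ}
    (hf : Measurable f) (hi : ∀ e, Integrable f (Q e)) : Measurable fun e => ∫ x, f x ∂(Q e) := by
  have : (fun e => ∫ x, f x ∂(Q e)) = fun e => (∫⁻ x, ENNReal.ofReal (f x) ∂(Q e)).toReal
      - (∫⁻ x, ENNReal.ofReal (-f x) ∂(Q e)).toReal :=
    funext fun e => integral_eq_lintegral_pos_part_sub_lintegral_neg_part (hi e)
  rw [this]
  have h1 : Measurable fun e => ∫⁻ x, ENNReal.ofReal (f x) ∂(Q e) :=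
    (Measure.measurable_lintegral (by fun_prop)).comp hQ
  have h2 : Measurable fun e => ∫⁻ x, ENNReal.ofReal (-f x) ∂(Q e) :=
    (Measure.measurable_lintegral (by fun_prop)).comp hQ
  exact h1.ennreal_toReal.sub h2.ennreal_toReal

namespace HasCompactMoments

variable (hQ : HasCompactMoments Q m)

include hQ

theorem measurable_integral {f : ℝ → ℝ} (hf : IsTest f) : Measurable fun e => ∫ x, f x ∂(Q e) :=
  measurable_integral_family hQ.measurable hf.measurable fun e =>
    have := hQ.finite e; hf.integrable _

omit hQ [MeasurableSpace E] in
theorem exists_enorm_integral_le (Q : E → Measure ℝ) {f : ℝ → ℝ} (hf : IsTest f) :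
    ∃ (K : Set ℝ) (b : ℝ≥0), IsCompact K ∧ ∀ e, ‖∫ x, f x ∂(Q e)‖ₑ ≤ b * Q e K := by
  obtain ⟨K, b, hK, hb⟩ := hf.exists_bound
  exact ⟨K, b, hK, fun e => (enorm_integral_le_lintegral_enorm _).trans
    (hf.lintegral_enorm_le hK hb _)⟩

theorem integrable_integral {f : ℝ → ℝ} (hf : IsTest f) :
    Integrable (fun e => ∫ x, f x ∂(Q e)) m := by
  obtain ⟨K, b, hK, hb⟩ := exists_enorm_integral_le Q hf
  refine ⟨(hQ.measurable_integral hf).aestronglyMeasurable, (lintegral_mono hb).trans_lt ?_⟩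
  rw [lintegral_const_mul' _ _ ENNReal.coe_ne_top]
  exact ENNReal.mul_lt_top ENNReal.coe_lt_top (by simpa using hQ.moment K hK 1 (by simp) (by simp))

theorem integrable_mul {f g : ℝ → ℝ} (hf : IsTest f) (hg : IsTest g) :
    Integrable (fun e => (∫ x, f x ∂(Q e)) * ∫ x, g x ∂(Q e)) m := by
  obtain ⟨K, b, hK, hb⟩ := exists_enorm_integral_le Q hf
  obtain ⟨K', b', hK', hb'⟩ := exists_enorm_integral_le Q hg
  refine ⟨((hQ.measurable_integral hf).mul (hQ.measurable_integral hg)).aestronglyMeasurable, ?_⟩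
  have : ∀ e, ‖(∫ x, f x ∂(Q e)) * ∫ x, g x ∂(Q e)‖ₑ ≤ (b * b' : ℝ≥0) * Q e (K ∪ K') ^ 2 := by
    intro e
    rw [enorm_mul, ENNReal.coe_mul]
    calc _ ≤ (b * Q e K) * (b' * Q e K') := mul_le_mul' (hb e) (hb' e)
      _ ≤ (b * Q e (K ∪ K')) * (b' * Q e (K ∪ K')) := by gcongr <;> simp
      _ = _ := by ring
  refine (lintegral_mono this).trans_lt ?_
  rw [lintegral_const_mul' _ _ ENNReal.coe_ne_top]
  exact ENNReal.mul_lt_top ENNReal.coe_lt_top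
    (hQ.moment _ (hK.union hK') 2 (by simp) (by simp))

theorem integrable_mul_mul {f g h : ℝ → ℝ} (hf : IsTest f) (hg : IsTest g) (hh : IsTest h) :
    Integrable (fun e => (∫ x, f x ∂(Q e)) * (∫ x, g x ∂(Q e)) * ∫ x, h x ∂(Q e)) m := by
  obtain ⟨K, b, hK, hb⟩ := exists_enorm_integral_le Q hf
  obtain ⟨K', b', hK', hb'⟩ := exists_enorm_integral_le Q hg
  obtain ⟨L, c, hL, hc⟩ := exists_enorm_integral_le Q hh
  refine ⟨(((hQ.measurable_integral hf).mul (hQ.measurable_integral hg)).mul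
    (hQ.measurable_integral hh)).aestronglyMeasurable, ?_⟩
  have : ∀ e, ‖(∫ x, f x ∂(Q e)) * (∫ x, g x ∂(Q e)) * ∫ x, h x ∂(Q e)‖ₑ ≤
      (b * b' * c : ℝ≥0) * Q e (K ∪ K' ∪ L) ^ 3 := by
    intro e
    rw [enorm_mul, enorm_mul, ENNReal.coe_mul, ENNReal.coe_mul]
    calc _ ≤ (b * Q e K) * (b' * Q e K') * (c * Q e L) :=
          mul_le_mul' (mul_le_mul' (hb e) (hb' e)) (hc e)
      _ ≤ (b * Q e (K ∪ K' ∪ L)) * (b' * Q e (K ∪ K' ∪ L)) * (c * Q e (K ∪ K' ∪ L)) := by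
          gcongr
          · exact subset_union_left.trans subset_union_left
          · exact subset_union_right.trans subset_union_left
          · exact subset_union_right
      _ = _ := by ring
  refine (lintegral_mono this).trans_lt ?_
  rw [lintegral_const_mul' _ _ ENNReal.coe_ne_top]
  exact ENNReal.mul_lt_top ENNReal.coe_lt_top
    (hQ.moment _ ((hK.union hK').union hL) 3 (by simp) (by simp))

theorem integrable_tripleSum {f g h : ℝ → ℝ} (hf : IsTest f) (hg : IsTest g) (hh : IsTest h) :
    Integrable (fun e => tripleSum (Q e) f g h) m :=
  ((((hQ.integrable_mul_mul hf hg hh).sub (hQ.integrable_mul (hf.mul hg) hh)).sub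
    (hQ.integrable_mul (hf.mul hh) hg)).sub (hQ.integrable_mul (hg.mul hh) hf)).add
    ((hQ.integrable_integral ((hf.mul hg).mul hh)).const_mul 2)

theorem integral_tripleSum {f g h : ℝ → ℝ} (hf : IsTest f) (hg : IsTest g) (hh : IsTest h) :
    ∫ e, tripleSum (Q e) f g h ∂m =
      ∫ e, (∫ x, f x ∂(Q e)) * (∫ x, g x ∂(Q e)) * ∫ x, h x ∂(Q e) ∂m
        - ∫ e, (∫ x, f x * g x ∂(Q e)) * ∫ x, h x ∂(Q e) ∂m
        - ∫ e, (∫ x, f x * h x ∂(Q e)) * ∫ x, g x ∂(Q e) ∂m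
        - ∫ e, (∫ x, g x * h x ∂(Q e)) * ∫ x, f x ∂(Q e) ∂m
        + 2 * ∫ e, ∫ x, f x * g x * h x ∂(Q e) ∂m :=
  integral_sub_sub_sub_add (hQ.integrable_mul_mul hf hg hh) (hQ.integrable_mul (hf.mul hg) hh)
    (hQ.integrable_mul (hf.mul hh) hg) (hQ.integrable_mul (hg.mul hh) hf)
    (hQ.integrable_integral ((hf.mul hg).mul hh))

variable {V : ℕ → Ω → E} {μ : Measure Ω}

/-- By Campbell's formula the integral of `‖f‖ₑ` against the superposition has finite mean. This
excludes the default value `0` of the Bochner integral when it is split over the members. -/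
theorem ae_integrable (h : IsPoissonToOrderThree V μ m) {f : ℝ → ℝ} (hf : IsTest f) :
    ∀ᵐ ω ∂μ, Integrable f (Measure.sum fun j => Q (V j ω)) := by
  have hm : Measurable fun e => ∫⁻ x, ‖f x‖ₑ ∂(Q e) :=
    (Measure.measurable_lintegral (by have := hf.measurable; fun_prop)).comp hQ.measurable
  have h1 := lintegral_tsum_points (μ := μ) h.measurable hm
  have h2 : ∫⁻ ω, ∑' j, ∫⁻ x, ‖f x‖ₑ ∂(Q (V j ω)) ∂μ ≠ ∞ := by
    rw [h1, h.intensity]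
    obtain ⟨K, b, hK, hb⟩ := hf.exists_bound
    refine ((lintegral_mono fun e => hf.lintegral_enorm_le hK hb (Q e)).trans_lt ?_).ne
    rw [lintegral_const_mul' _ _ ENNReal.coe_ne_top]
    exact ENNReal.mul_lt_top ENNReal.coe_lt_top
      (by simpa using hQ.moment K hK 1 (by simp) (by simp))
  filter_upwards [ae_lt_top (Measurable.tsum fun j => hm.comp (h.measurable j)) h2]
    with ω hω
  refine ⟨hf.measurable.aestronglyMeasurable, ?_⟩
  rw [HasFiniteIntegral, lintegral_sum_measure]
  exact hω

theorem ae_integral_eq (h : IsPoissonToOrderThree V μ m) {f : ℝ → ℝ} (hf : IsTest f) :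
    ∀ᵐ ω ∂μ, ∫ x, f x ∂(Measure.sum fun j => Q (V j ω)) =
      ∫ j, (∫ x, f x ∂(Q (V j ω))) ∂Measure.count := by
  filter_upwards [hQ.ae_integrable h hf] with ω hω
  have hc : Integrable (fun j => ∫ x, f x ∂(Q (V j ω))) Measure.count := by
    rw [integrable_count_iff]
    have h1 := (hasSum_integral_measure hω.norm).summable
    exact h1.of_nonneg_of_le (fun _ => norm_nonneg _) fun j => norm_integral_le_integral_norm _
  rw [integral_sum_measure hω]
  rw [Measure.count] at hc ⊢
  rw [integral_sum_measure hc]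
  exact tsum_congr fun j => (integral_dirac (fun j => ∫ x, f x ∂(Q (V j ω))) j).symm

variable {N : Ω → Measure ℝ} [SFinite μ]

/-- Each of the five terms of the third-moment expansion is a product of moments of `Q e K` of
orders one to three, all finite. -/
theorem lintegral_cube_lt_top (h : IsPoissonToOrderThree V μ m)
    (hN : ∀ᵐ ω ∂μ, N ω = Measure.sum fun j => Q (V j ω)) [SFinite m] {K : Set ℝ} (hK : IsCompact K) :
    ∫⁻ ω, (N ω K) ^ 3 ∂μ < ∞ := by
  have hm : Measurable fun e => Q e K :=
    (Measure.measurable_coe hK.measurableSet).comp hQ.measurable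
  have h1 : ∫⁻ ω, (N ω K) ^ 3 ∂μ = ∫⁻ ω, (∑' j, Q (V j ω) K) *
      ((∑' j, Q (V j ω) K) * ∑' j, Q (V j ω) K) ∂μ := by
    refine lintegral_congr_ae ?_
    filter_upwards [hN] with ω hω
    rw [hω, Measure.sum_apply _ hK.measurableSet]
    ring
  have f1 : ∫⁻ e, Q e K ∂m < ∞ := by simpa using hQ.moment K hK 1 (by simp) (by simp)
  have f2 := hQ.moment K hK 2 (by simp) (by simp)
  have f3 := hQ.moment K hK 3 (by simp) (by simp)
  have hsq : Measurable fun e => Q e K ^ 2 := hm.pow_const 2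
  rw [h1, lintegral_tsum_mul_mul h.measurable hm hm hm, h.intensity, h.pair, h.triple]
  have e1 : ∫⁻ x : E × E × E, Q x.1 K * (Q x.2.1 K * Q x.2.2 K) ∂(m.prod (m.prod m)) < ∞ := by
    rw [lintegral_prod_mul (f := fun e => Q e K) (g := fun x : E × E => Q x.1 K * Q x.2 K)
      hm.aemeasurable (by fun_prop), lintegral_prod_mul (f := fun e => Q e K)
      (g := fun e => Q e K) hm.aemeasurable hm.aemeasurable]
    exact ENNReal.mul_lt_top f1 (ENNReal.mul_lt_top f1 f1)
  have hpair : ∫⁻ x : E × E, Q x.1 K ^ 2 * Q x.2 K ∂(m.prod m) < ∞ := by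
    rw [lintegral_prod_mul (f := fun e => Q e K ^ 2) (g := fun e => Q e K)
      hsq.aemeasurable hm.aemeasurable]
    exact ENNReal.mul_lt_top f2 f1
  refine ENNReal.add_lt_top.2 ⟨ENNReal.add_lt_top.2 ⟨ENNReal.add_lt_top.2
    ⟨ENNReal.add_lt_top.2 ⟨e1, ?_⟩, ?_⟩, ?_⟩, ?_⟩
  · refine lt_of_eq_of_lt (lintegral_congr fun x => ?_) hpair; ring
  · refine lt_of_eq_of_lt (lintegral_congr fun x => ?_) hpair; ring
  · refine lt_of_eq_of_lt (lintegral_congr fun x => ?_) hpair; ring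
  · refine lt_of_eq_of_lt (lintegral_congr fun x => ?_) f3; ring

/-- The third factorial cumulant of a Poisson superposition: only the triples of points that
belong to the same member of the superposition contribute. -/
theorem thirdFactorialCumulant_eq (h : IsPoissonToOrderThree V μ m)
    (hN : ∀ᵐ ω ∂μ, N ω = Measure.sum fun j => Q (V j ω)) [SFinite m] {f₀ f₁ f₂ : ℝ → ℝ}
    (h₀ : IsTest f₀) (h₁ : IsTest f₁) (h₂ : IsTest f₂) :
    thirdFactorialCumulant N μ f₀ f₁ f₂ = ∫ e, tripleSum (Q e) f₀ f₁ f₂ ∂m := by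
  have hS : ∀ {f : ℝ → ℝ}, IsTest f → ∀ᵐ ω ∂μ, ∫ x, f x ∂(N ω) =
      ∫ j, (∫ x, f x ∂(Q (V j ω))) ∂Measure.count := by
    intro f hf
    filter_upwards [hN, hQ.ae_integral_eq h hf] with ω h1 h2
    rw [h1, h2]
  have a1 : ∀ {f : ℝ → ℝ}, IsTest f → factorialMoment₁ N μ f = ∫ e, ∫ x, f x ∂(Q e) ∂m := by
    intro f hf
    rw [factorialMoment₁, integral_congr_ae (hS hf)]
    exact (h.integral_sum (hQ.integrable_integral hf)).2
  have s1 := fun {f : ℝ → ℝ} (hf : IsTest f) => h.integral_sum (hQ.integrable_integral hf)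
  have s2 := fun {f g : ℝ → ℝ} (hf : IsTest f) (hg : IsTest g) =>
    h.integral_mul (hQ.integrable_integral hf) (hQ.integrable_integral hg)
      (hQ.integrable_mul hf hg) (hQ.measurable_integral hf) (hQ.measurable_integral hg)
  have a2 : ∀ {f g : ℝ → ℝ}, IsTest f → IsTest g → factorialMoment₂ N μ f g =
      (∫ e, ∫ x, f x ∂(Q e) ∂m) * (∫ e, ∫ x, g x ∂(Q e) ∂m)
        + ∫ e, (∫ x, f x ∂(Q e)) * (∫ x, g x ∂(Q e)) ∂m - ∫ e, ∫ x, f x * g x ∂(Q e) ∂m := by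
    intro f g hf hg
    rw [← (s2 hf hg).2, ← (s1 (hf.mul hg)).2, ← integral_sub (s2 hf hg).1 (s1 (hf.mul hg)).1,
      factorialMoment₂]
    refine integral_congr_ae ?_
    filter_upwards [hS hf, hS hg, hS (hf.mul hg)] with ω e1 e2 e3
    rw [pairSum, e1, e2, e3]
  have s3 := h.integral_mul_mul (hQ.integrable_integral h₀) (hQ.integrable_integral h₁)
    (hQ.integrable_integral h₂) (hQ.integrable_mul h₀ h₁) (hQ.integrable_mul h₀ h₂)
    (hQ.integrable_mul h₁ h₂) (hQ.integrable_mul_mul h₀ h₁ h₂) (hQ.measurable_integral h₀)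
    (hQ.measurable_integral h₁) (hQ.measurable_integral h₂)
  have h₀₁ := h₀.mul h₁
  have h₀₂ := h₀.mul h₂
  have h₁₂ := h₁.mul h₂
  have h₀₁₂ := h₀₁.mul h₂
  have a3 := integral_sub_sub_sub_add s3.1 (s2 h₀₁ h₂).1 (s2 h₀₂ h₁).1 (s2 h₁₂ h₀).1 (s1 h₀₁₂).1
  rw [s3.2, (s2 h₀₁ h₂).2, (s2 h₀₂ h₁).2, (s2 h₁₂ h₀).2, (s1 h₀₁₂).2] at a3
  have a3' : factorialMoment₃ N μ f₀ f₁ f₂ = _ := (integral_congr_ae (by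
    filter_upwards [hS h₀, hS h₁, hS h₂, hS h₀₁, hS h₀₂, hS h₁₂, hS h₀₁₂]
      with ω e1 e2 e3 e4 e5 e6 e7
    rw [tripleSum, e1, e2, e3, e4, e5, e6, e7])).trans a3
  -- Both sides are now polynomials in integrals over `m`. Products of two or more integrals cancel,
  -- and the single integrals left are those of `tripleSum`.
  rw [thirdFactorialCumulant, a3', a2 h₀ h₁, a2 h₀ h₂, a2 h₁ h₂, a1 h₀, a1 h₁, a1 h₂,
    hQ.integral_tripleSum h₀ h₁ h₂]
  ring

end HasCompactMoments

end Superposition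

end PoissonCluster

namespace PoissonCluster

/-! ### Translated clusters and the cumulant of the cluster process -/

section ShiftedClusters

/-- The masses need not be uniformly bounded, so the kernel is cut according to the integer part of
its total mass. -/
theorem isSFiniteKernel_of_isFiniteMeasure {α β : Type*} [MeasurableSpace α] [MeasurableSpace β]
    (κ : Kernel α β) (h : ∀ a, IsFiniteMeasure (κ a)) : IsSFiniteKernel κ := by
  have hm : Measurable fun a => ⌊(κ a univ).toReal⌋₊ :=
    Nat.measurable_floor.comp (κ.measurable_coe MeasurableSet.univ).ennreal_toReal
  have hs : ∀ n : ℕ, MeasurableSet {a | ⌊(κ a univ).toReal⌋₊ = n} := fun n =>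
    hm (measurableSet_singleton n)
  classical
  have hfin : ∀ n, IsFiniteKernel (Kernel.piecewise (hs n) κ 0) := fun n => by
    refine ⟨⟨(n + 1 : ℕ), ENNReal.natCast_lt_top _, fun a => ?_⟩⟩
    rw [Kernel.piecewise_apply']
    split_ifs with ha
    · have h1 := (Nat.lt_floor_add_one (κ a univ).toReal).le
      rw [mem_ofPred_eq] at ha
      rw [ha] at h1
      have := h a
      rw [← ENNReal.ofReal_toReal (measure_ne_top (κ a) univ), ← ENNReal.ofReal_natCast]
      exact ENNReal.ofReal_le_ofReal (by exact_mod_cast h1)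
    · simp
  have heq : κ = Kernel.sum fun n => Kernel.piecewise (hs n) κ 0 := by
    ext a s hs'
    rw [Kernel.sum_apply' _ _ hs', tsum_eq_single ⌊(κ a univ).toReal⌋₊]
    · rw [Kernel.piecewise_apply']
      exact (if_pos (show a ∈ {b | _ = _} from rfl)).symm
    · intro n hn
      exact (Kernel.piecewise_apply' _ _).trans (if_neg (Ne.symm hn))
  rw [heq]
  exact Kernel.isSFiniteKernel_sum

open Classical in
/-- The measure itself if it is finite, and `0` otherwise. -/
noncomputable def finitePart (c : Measure ℝ) : Measure ℝ := if c univ = ∞ then 0 else c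

instance (c : Measure ℝ) : IsFiniteMeasure (finitePart c) := by
  rw [finitePart]
  split_ifs with h
  · infer_instance
  · exact ⟨lt_top_iff_ne_top.2 h⟩

theorem finitePart_of_ne_top {c : Measure ℝ} (h : c univ ≠ ∞) : finitePart c = c := if_neg h

theorem finitePart_le (c : Measure ℝ) : finitePart c ≤ c := by
  rw [finitePart]
  split_ifs
  · exact Measure.zero_le c
  · exact le_rfl

theorem measurable_finitePart : Measurable finitePart := by
  refine Measurable.ite ?_ measurable_const measurable_id
  exact (Measure.measurable_coe MeasurableSet.univ) (measurableSet_singleton ∞)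

/-- The finite part of the measure `e.2`, translated by `e.1`. -/
noncomputable def shiftedCluster (e : ℝ × Measure ℝ) : Measure ℝ :=
  (finitePart e.2).map fun x => x + e.1

instance (e : ℝ × Measure ℝ) : IsFiniteMeasure (shiftedCluster e) := by
  rw [shiftedCluster]
  infer_instance

/-- Truncation to the finite part makes `e ↦ finitePart e.2` an s-finite kernel, so its sections
depend measurably on translation and measure jointly. It also gives the finiteness for every `e`
that `HasCompactMoments` demands. -/
theorem measurable_shiftedCluster : Measurable shiftedCluster := by
  let κ : Kernel (ℝ × Measure ℝ) ℝ :=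
    ⟨fun e => finitePart e.2, measurable_finitePart.comp measurable_snd⟩
  have hκ : IsSFiniteKernel κ := isSFiniteKernel_of_isFiniteMeasure κ fun e =>
    inferInstanceAs (IsFiniteMeasure (finitePart e.2))
  refine Measure.measurable_of_measurable_coe _ fun s hs => ?_
  have ht : MeasurableSet {p : (ℝ × Measure ℝ) × ℝ | p.2 + p.1.1 ∈ s} :=
    (by fun_prop : Measurable fun p : (ℝ × Measure ℝ) × ℝ => p.2 + p.1.1) hs
  have := Kernel.measurable_kernel_prodMk_left (κ := κ) ht
  have heq : (fun e => shiftedCluster e s) =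
      fun e => κ e (Prod.mk e ⁻¹' {p : (ℝ × Measure ℝ) × ℝ | p.2 + p.1.1 ∈ s}) := by
    funext e
    rw [shiftedCluster, Measure.map_apply (by fun_prop) hs]
    rfl
  rwa [heq]

theorem shiftedCluster_univ (e : ℝ × Measure ℝ) : shiftedCluster e univ = finitePart e.2 univ := by
  rw [shiftedCluster, Measure.map_apply (by fun_prop) MeasurableSet.univ, preimage_univ]

theorem lintegral_shiftedCluster (c : Measure ℝ) {K : Set ℝ} (hK : MeasurableSet K) :
    ∫⁻ u, shiftedCluster (u, c) K ∂volume = finitePart c univ * volume K := by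
  have h1 : ∀ u, shiftedCluster (u, c) K = ∫⁻ x, K.indicator 1 (x + u) ∂(finitePart c) := by
    intro u
    rw [shiftedCluster, ← lintegral_indicator_one hK,
      lintegral_map (measurable_one.indicator hK) (by fun_prop)]
  have hm : Measurable fun p : ℝ × ℝ => K.indicator (1 : ℝ → ℝ≥0∞) (p.2 + p.1) :=
    (measurable_one.indicator hK).comp (by fun_prop)
  simp only [h1]
  rw [lintegral_lintegral_swap hm.aemeasurable]
  have h2 : ∀ x, ∫⁻ u, K.indicator (1 : ℝ → ℝ≥0∞) (x + u) ∂volume = volume K := by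
    intro x
    rw [lintegral_add_left_eq_self (fun u => K.indicator (1 : ℝ → ℝ≥0∞) u) x,
      lintegral_indicator_one hK]
  simp only [h2, lintegral_const]
  rw [mul_comm]

/-- Only one factor of the `p`-th power keeps the set `K`; the others are bounded by the total mass.
Integrating that factor over translations gives `volume K` times the total mass, so the third moment
of the mass suffices. -/
theorem hasCompactMoments_shiftedCluster (ν : ℝ≥0) (L : Measure (Measure ℝ))
    [IsProbabilityMeasure L] (hL : ∫⁻ c, (c univ) ^ 3 ∂L < ∞) :
    HasCompactMoments shiftedCluster ((ν • volume).prod L) where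
  measurable := measurable_shiftedCluster
  finite := inferInstance
  moment K hK p hp hp3 := by
    obtain ⟨q, rfl⟩ := Nat.exists_eq_succ_of_ne_zero hp
    have hm : Measurable fun e => shiftedCluster e K :=
      (Measure.measurable_coe hK.measurableSet).comp measurable_shiftedCluster
    have hu : Measurable fun c : Measure ℝ => finitePart c univ :=
      (Measure.measurable_coe MeasurableSet.univ).comp measurable_finitePart
    have h1 : ∀ e, shiftedCluster e K ^ (q + 1) ≤
        shiftedCluster e K * finitePart e.2 univ ^ q := by
      intro e
      rw [pow_succ', ← shiftedCluster_univ]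
      gcongr
      exact subset_univ K
    refine (lintegral_mono h1).trans_lt ?_
    have hmu : Measurable fun e : ℝ × Measure ℝ =>
        shiftedCluster e K * finitePart e.2 univ ^ q :=
      hm.mul ((hu.comp measurable_snd).pow_const q)
    rw [lintegral_prod_symm' _ hmu]
    have h2 : ∀ c : Measure ℝ, ∫⁻ u, shiftedCluster (u, c) K * finitePart c univ ^ q
        ∂(ν • volume : Measure ℝ) ≤ ν * volume K * (1 + (c univ) ^ 3) := by
      intro c
      have hmc : Measurable fun u => shiftedCluster (u, c) K :=
        hm.comp (by fun_prop : Measurable fun u : ℝ => (u, c))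
      rw [lintegral_mul_const _ hmc,
        lintegral_smul_measure, lintegral_shiftedCluster c hK.measurableSet]
      have h3 : finitePart c univ ^ (q + 1) ≤ 1 + (c univ) ^ 3 := by
        rcases le_total (finitePart c univ) 1 with h | h
        · exact (pow_le_one₀ (zero_le) h).trans le_self_add
        · calc finitePart c univ ^ (q + 1) ≤ finitePart c univ ^ 3 := pow_le_pow_right₀ h hp3
            _ ≤ (c univ) ^ 3 := by gcongr; exact finitePart_le c
            _ ≤ _ := le_add_self
      calc ν • (finitePart c univ * volume K) * finitePart c univ ^ q
          = ν * volume K * finitePart c univ ^ (q + 1) := by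
            rw [ENNReal.smul_def, smul_eq_mul]; ring
        _ ≤ _ := by gcongr
    refine (lintegral_mono h2).trans_lt ?_
    have hfin : (ν : ℝ≥0∞) * volume K ≠ ∞ :=
      ENNReal.mul_ne_top ENNReal.coe_ne_top hK.measure_lt_top.ne
    rw [lintegral_const_mul' _ _ hfin, lintegral_add_left measurable_const]
    refine ENNReal.mul_lt_top hfin.lt_top (ENNReal.add_lt_top.2 ⟨by simp, hL⟩)

theorem tripleSum_shiftedCluster (u : ℝ) {c : Measure ℝ} (hc : c univ ≠ ∞) {f g h : ℝ → ℝ}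
    (hf : Measurable f) (hg : Measurable g) (hh : Measurable h) :
    tripleSum (shiftedCluster (u, c)) f g h =
      tripleSum c (fun x => f (x + u)) (fun x => g (x + u)) (fun x => h (x + u)) := by
  have key : ∀ {φ : ℝ → ℝ}, Measurable φ →
      ∫ x, φ x ∂(shiftedCluster (u, c)) = ∫ x, φ (x + u) ∂c := by
    intro φ hφ
    rw [shiftedCluster, integral_map (by fun_prop) hφ.aestronglyMeasurable, finitePart_of_ne_top hc]
  simp only [tripleSum]
  rw [key hf, key hg, key hh, key (φ := fun x => f x * g x) (hf.mul hg),
    key (φ := fun x => f x * h x) (hf.mul hh), key (φ := fun x => g x * h x) (hg.mul hh),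
    key (φ := fun x => f x * g x * h x) ((hf.mul hg).mul hh)]

variable {Ω₀ Ω : Type*} [MeasurableSpace Ω₀] [MeasurableSpace Ω] {P : Measure Ω₀}
  [IsProbabilityMeasure P] {μ : Measure Ω} [IsProbabilityMeasure μ] {C₀ : Ω₀ → Measure ℝ} {ν : ℝ≥0}
  {U : ℕ → Ω → ℝ} {C : ℕ → Ω → Measure ℝ}

namespace IsPoissonClusterSystem

variable (h : IsPoissonClusterSystem U C ν μ C₀ P) (hmoment : ∫⁻ ω, (C₀ ω univ) ^ 3 ∂P < ∞)

include h hmoment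

omit [IsProbabilityMeasure P] [IsProbabilityMeasure μ] in
theorem lintegral_law_cube_lt_top : ∫⁻ c, (c univ) ^ 3 ∂(P.map C₀) < ∞ := by
  rwa [lintegral_map' ((Measure.measurable_coe MeasurableSet.univ).pow_const 3).aemeasurable
    (h.identDistrib 0).aemeasurable_snd]

omit [IsProbabilityMeasure P] [IsProbabilityMeasure μ] in
theorem ae_cluster_ne_top : ∀ᵐ c ∂(P.map C₀), c univ ≠ ∞ := by
  have hm : Measurable fun c : Measure ℝ => (c univ) ^ 3 :=
    (Measure.measurable_coe MeasurableSet.univ).pow_const 3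
  have hfin : ∫⁻ c, (c univ) ^ 3 ∂(P.map C₀) ≠ ∞ := by
    rw [lintegral_map' hm.aemeasurable (h.identDistrib 0).aemeasurable_snd]
    exact hmoment.ne
  filter_upwards [ae_lt_top hm hfin] with c hc htop
  simp [htop] at hc

-- A finite third moment forces almost surely finite clusters, so the truncation in `shiftedCluster`
-- changes nothing almost surely.
omit [IsProbabilityMeasure P] [IsProbabilityMeasure μ] in
theorem ae_clusterProcess_eq :
    ∀ᵐ ω ∂μ, clusterProcess U C ω = Measure.sum fun j => shiftedCluster (U j ω, C j ω) := by
  have hfin : ∀ᵐ ω ∂μ, ∀ j, C j ω univ ≠ ∞ := by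
    rw [ae_all_iff]
    intro j
    have := h.ae_cluster_ne_top hmoment
    rw [← (h.identDistrib j).map_eq] at this
    exact ae_of_ae_map (h.measurable_cluster j).aemeasurable this
  filter_upwards [hfin] with ω hω
  rw [clusterProcess]
  congr 1
  funext j
  rw [shiftedCluster, finitePart_of_ne_top (hω j)]

theorem lintegral_clusterProcess_cube_lt_top (hν : 0 < ν) {K : Set ℝ} (hK : IsCompact K) :
    ∫⁻ ω, (clusterProcess U C ω K) ^ 3 ∂μ < ∞ := by
  have : IsProbabilityMeasure (P.map C₀) :=
    Measure.isProbabilityMeasure_map (h.identDistrib 0).aemeasurable_snd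
  exact (hasCompactMoments_shiftedCluster ν _
    (h.lintegral_law_cube_lt_top hmoment)).lintegral_cube_lt_top (h.isPoissonToOrderThree hν)
    (h.ae_clusterProcess_eq hmoment) hK

theorem thirdFactorialCumulant_eq (hν : 0 < ν) {f₀ f₁ f₂ : ℝ → ℝ} (h₀ : IsTest f₀)
    (h₁ : IsTest f₁) (h₂ : IsTest f₂) :
    thirdFactorialCumulant (clusterProcess U C) μ f₀ f₁ f₂ =
      ν * ∫ u, ∫ ω, tripleSum (C₀ ω) (fun x => f₀ (x + u)) (fun x => f₁ (x + u))
        (fun x => f₂ (x + u)) ∂P := by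
  have : IsProbabilityMeasure (P.map C₀) :=
    Measure.isProbabilityMeasure_map (h.identDistrib 0).aemeasurable_snd
  have hQ := hasCompactMoments_shiftedCluster ν _ (h.lintegral_law_cube_lt_top hmoment)
  rw [hQ.thirdFactorialCumulant_eq (h.isPoissonToOrderThree hν)
    (h.ae_clusterProcess_eq hmoment) h₀ h₁ h₂,
    integral_prod _ (hQ.integrable_tripleSum h₀ h₁ h₂), integral_smul_nnreal_measure,
    NNReal.smul_def, smul_eq_mul]
  congr 1
  refine integral_congr_ae (ae_of_all _ fun u => ?_)
  have hm : ∀ {f : ℝ → ℝ}, IsTest f → Measurable fun c => ∫ x, f x ∂(shiftedCluster (u, c)) :=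
    fun hf => (hQ.measurable_integral hf).comp (by fun_prop : Measurable fun c : Measure ℝ => (u, c))
  have hmeas : Measurable fun c => tripleSum (shiftedCluster (u, c)) f₀ f₁ f₂ := by
    have m1 := hm h₀
    have m2 := hm h₁
    have m3 := hm h₂
    have m4 := hm (h₀.mul h₁)
    have m5 := hm (h₀.mul h₂)
    have m6 := hm (h₁.mul h₂)
    have m7 := hm ((h₀.mul h₁).mul h₂)
    simp only [tripleSum]
    fun_prop
  change ∫ c, tripleSum (shiftedCluster (u, c)) f₀ f₁ f₂ ∂(P.map C₀) = _
  rw [integral_map (h.identDistrib 0).aemeasurable_snd hmeas.aestronglyMeasurable]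
  refine integral_congr_ae ?_
  filter_upwards [ae_of_ae_map (h.identDistrib 0).aemeasurable_snd (h.ae_cluster_ne_top hmoment)]
    with ω hω
  exact tripleSum_shiftedCluster u hω h₀.measurable h₁.measurable h₂.measurable

end IsPoissonClusterSystem

end ShiftedClusters

end PoissonCluster

namespace PoissonCluster

/-! ### The measure of distinct triples in a random finite set -/

section TripleLaw

variable {Ω ι : Type*}

/-- The triples of distinct elements of the random set `S`. -/
def distinctTriples (S : Ω → Set ι) : Set (Ω × ι × ι × ι) :=
  {q | (q.2.1 ≠ q.2.2.1 ∧ q.2.1 ≠ q.2.2.2 ∧ q.2.2.1 ≠ q.2.2.2) ∧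
    q.2.1 ∈ S q.1 ∧ q.2.2.1 ∈ S q.1 ∧ q.2.2.2 ∈ S q.1}

theorem sum_dirac_eq_finset_sum {S : Set ι} {s : Finset ι} (hS : S = s) (x : ι → ℝ) :
    (Measure.sum fun v : S => Measure.dirac (x v)) = ∑ i ∈ s, Measure.dirac (x i) := by
  subst hS
  exact Measure.sum_coe_finset s fun i => Measure.dirac (x i)

theorem finset_sum_dirac_univ (s : Finset ι) (x : ι → ℝ) :
    (∑ i ∈ s, Measure.dirac (x i)) univ = s.card := by
  simp [Measure.finsetSum_apply]

theorem integral_count_eq_finset_sum [MeasurableSpace ι] [Countable ι] [MeasurableSingletonClass ι]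
    {φ : ι → ℝ} (t : Finset ι) (h : ∀ p ∉ t, φ p = 0) : ∫ p, φ p ∂Measure.count = ∑ p ∈ t, φ p := by
  have hi : Integrable φ Measure.count := by
    rw [integrable_count_iff]
    exact summable_of_ne_finset_zero (s := t) fun p hp => by simp [h p hp]
  rw [Measure.count] at hi ⊢
  rw [integral_sum_measure hi, ← tsum_eq_sum (L := SummationFilter.unconditional ι) (s := t) h]
  exact tsum_congr fun p => integral_dirac _ _

variable [MeasurableSpace Ω] [MeasurableSpace ι] [Countable ι] [MeasurableSingletonClass ι]

theorem measurableSet_distinctTriples {S : Ω → Set ι} (hS : Measurable S) :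
    MeasurableSet (distinctTriples S) := by
  refine measurableSet_setOfPred.2 (measurable_from_prod_countable_left fun p => ?_)
  have hmem : ∀ i, MeasurableSet {ω | i ∈ S ω} := fun i => hS (measurableSet_mem i)
  by_cases hp : p.1 ≠ p.2.1 ∧ p.1 ≠ p.2.2 ∧ p.2.1 ≠ p.2.2
  · have : Measurable fun ω => p.1 ∈ S ω ∧ p.2.1 ∈ S ω ∧ p.2.2 ∈ S ω := measurableSet_setOfPred.1
      (((hmem p.1).inter ((hmem p.2.1).inter (hmem p.2.2))))
    simpa [hp] using this
  · simp [hp]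

/-- The sum over the triples of distinct elements of the random set `S` of the law of the triple of
their positions. -/
noncomputable def tripleLaw (S : Ω → Set ι) (X : ι → Ω → ℝ) (P : Measure Ω) :
    Measure (ℝ × ℝ × ℝ) :=
  ((P.prod Measure.count).restrict (distinctTriples S)).map
    fun q => (X q.2.1 q.1, X q.2.2.1 q.1, X q.2.2.2 q.1)

variable {S : Ω → Set ι} {X : ι → Ω → ℝ} {P : Measure Ω}

theorem measurable_triple (hX : ∀ i, Measurable (X i)) :
    Measurable fun q : Ω × ι × ι × ι => (X q.2.1 q.1, X q.2.2.1 q.1, X q.2.2.2 q.1) :=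
  measurable_from_prod_countable_left fun p =>
    (hX p.1).prodMk ((hX p.2.1).prodMk (hX p.2.2))

theorem isFiniteMeasure_tripleLaw (hS : Measurable S) (hX : ∀ i, Measurable (X i))
    (hfin : ∀ᵐ ω ∂P, (S ω).Finite)
    (hmom : ∫⁻ ω, ((Measure.sum fun v : S ω => Measure.dirac (X v ω)) univ) ^ 3 ∂P < ∞) :
    IsFiniteMeasure (tripleLaw S X P) := by
  classical
  refine ⟨?_⟩
  rw [tripleLaw, Measure.map_apply (measurable_triple hX) MeasurableSet.univ, preimage_univ,
    Measure.restrict_apply_univ, Measure.prod_apply (measurableSet_distinctTriples hS)]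
  refine (lintegral_mono_ae ?_).trans_lt hmom
  filter_upwards [hfin] with ω hω
  obtain ⟨s, hs⟩ := hω.exists_finset_coe
  have hsub : Prod.mk ω ⁻¹' distinctTriples S ⊆ ((s ×ˢ s ×ˢ s : Finset (ι × ι × ι)) : Set _) := by
    rintro p ⟨-, h1, h2, h3⟩
    simp only [← hs] at h1 h2 h3
    simp only [Finset.coe_product]
    exact ⟨h1, h2, h3⟩
  rw [sum_dirac_eq_finset_sum hs.symm fun i => X i ω, finset_sum_dirac_univ]
  refine (measure_mono hsub).trans_eq ?_
  rw [Measure.count_apply_finset]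
  simp only [Finset.card_product]
  push_cast
  ring

/-- Boundedness without compact support is enough because `tripleLaw` is finite. The constant
function `1` is thus admissible and gives the total mass. -/
theorem integral_tripleSum_eq [SFinite P] (hS : Measurable S) (hX : ∀ i, Measurable (X i))
    (hfin : ∀ᵐ ω ∂P, (S ω).Finite) [IsFiniteMeasure (tripleLaw S X P)]
    {f g h : ℝ → ℝ} (hf : Measurable f) (hg : Measurable g) (hh : Measurable h)
    (bf : ∃ b, ∀ x, |f x| ≤ b) (bg : ∃ b, ∀ x, |g x| ≤ b) (bh : ∃ b, ∀ x, |h x| ≤ b) :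
    ∫ ω, tripleSum (Measure.sum fun v : S ω => Measure.dirac (X v ω)) f g h ∂P =
      ∫ x, f x.1 * g x.2.1 * h x.2.2 ∂(tripleLaw S X P) := by
  classical
  obtain ⟨b₀, hb₀⟩ := bf
  obtain ⟨b₁, hb₁⟩ := bg
  obtain ⟨b₂, hb₂⟩ := bh
  set Φ : ℝ × ℝ × ℝ → ℝ := fun x => f x.1 * g x.2.1 * h x.2.2 with hΦ
  have hΦm : Measurable Φ := by fun_prop
  have hi : Integrable Φ (tripleLaw S X P) := by
    refine Integrable.of_bound hΦm.aestronglyMeasurable (b₀ * b₁ * b₂) (ae_of_all _ fun x => ?_)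
    rw [hΦ, Real.norm_eq_abs, abs_mul, abs_mul]
    have n0 := (abs_nonneg _).trans (hb₀ 0)
    have n1 := (abs_nonneg _).trans (hb₁ 0)
    exact mul_le_mul (mul_le_mul (hb₀ _) (hb₁ _) (abs_nonneg _) n0) (hb₂ _) (abs_nonneg _)
      (mul_nonneg n0 n1)
  have hm := measurable_triple hX
  have hA := measurableSet_distinctTriples hS
  rw [tripleLaw] at hi ⊢
  have hi' : IntegrableOn (fun q : Ω × ι × ι × ι => Φ (X q.2.1 q.1, X q.2.2.1 q.1, X q.2.2.2 q.1))
      (distinctTriples S) (P.prod Measure.count) :=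
    (integrable_map_measure hΦm.aestronglyMeasurable hm.aemeasurable).1 hi
  rw [integral_map hm.aemeasurable hΦm.aestronglyMeasurable, ← integral_indicator hA,
    integral_prod _ (hi'.integrable_indicator hA)]
  refine integral_congr_ae ?_
  filter_upwards [hfin] with ω hω
  obtain ⟨s, hs⟩ := hω.exists_finset_coe
  rw [sum_dirac_eq_finset_sum hs.symm fun i => X i ω, tripleSum_sum_dirac,
    integral_count_eq_finset_sum (s ×ˢ s ×ˢ s), Finset.sum_product]
  · refine Finset.sum_congr rfl fun i hi => ?_
    rw [Finset.sum_product]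
    refine Finset.sum_congr rfl fun j hj => Finset.sum_congr rfl fun k hk => ?_
    simp only [indicator_apply]
    refine if_congr ?_ rfl rfl
    change _ ↔ _ ∧ i ∈ S ω ∧ j ∈ S ω ∧ k ∈ S ω
    rw [← hs]
    simp [hi, hj, hk]
  · rintro ⟨i, j, k⟩ hp
    refine indicator_of_notMem ?_ _
    rintro ⟨-, h1, h2, h3⟩
    simp only [← hs] at h1 h2 h3
    exact hp (Finset.mem_product.2 ⟨h1, Finset.mem_product.2 ⟨h2, h3⟩⟩)

/-- The image of the law of the triples is absolutely continuous if, for each possible value of the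
random set, the image of the law of each triple is. -/
theorem map_tripleLaw_absolutelyContinuous [IsFiniteMeasure P] (hS : Measurable S)
    (hX : ∀ i, Measurable (X i))
    (hfin : ∀ᵐ ω ∂P, (S ω).Finite) {F : Type*} [MeasurableSpace F] {ρ : Measure F}
    {φ : ℝ × ℝ × ℝ → F} (hφ : Measurable φ)
    (hac : ∀ τ : Finset ι, P {ω | S ω = (τ : Set ι)} ≠ 0 → ∀ i ∈ τ, ∀ j ∈ τ, ∀ k ∈ τ,
      i ≠ j → i ≠ k → j ≠ k →
      (P[|{ω | S ω = (τ : Set ι)}]).map (fun ω => φ (X i ω, X j ω, X k ω)) ≪ ρ) :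
    (tripleLaw S X P).map φ ≪ ρ := by
  refine Measure.AbsolutelyContinuous.mk fun N hN hρN => ?_
  have hm := measurable_triple hX
  have hA := measurableSet_distinctTriples hS
  rw [tripleLaw, Measure.map_map hφ hm, Measure.map_apply (hφ.comp hm) hN,
    Measure.restrict_apply ((hφ.comp hm) hN),
    Measure.prod_apply_symm (((hφ.comp hm) hN).inter hA), lintegral_count, ENNReal.tsum_eq_zero]
  rintro ⟨i, j, k⟩
  by_cases hd : i ≠ j ∧ i ≠ k ∧ j ≠ k
  swap
  · refine measure_mono_null (t := ∅) ?_ measure_empty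
    rintro ω ⟨-, h, -⟩
    exact hd h
  -- A countable type has countably many finite subsets, so up to a null event it suffices to treat
  -- each value `τ` of the random set.
  have hcov : (fun ω => (ω, i, j, k)) ⁻¹'
      ((φ ∘ fun q : Ω × ι × ι × ι => (X q.2.1 q.1, X q.2.2.1 q.1, X q.2.2.2 q.1)) ⁻¹' N
        ∩ distinctTriples S) ⊆
      {ω | ¬ (S ω).Finite} ∪ ⋃ τ : Finset ι, {ω | S ω = (τ : Set ι)} ∩
        {ω | φ (X i ω, X j ω, X k ω) ∈ N ∧ i ∈ S ω ∧ j ∈ S ω ∧ k ∈ S ω} := by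
    rintro ω ⟨h1, -, h2⟩
    by_cases hω : (S ω).Finite
    · obtain ⟨s, hs⟩ := hω.exists_finset_coe
      exact Or.inr (mem_iUnion.2 ⟨s, hs.symm, h1, h2⟩)
    · exact Or.inl hω
  refine measure_mono_null hcov (measure_union_null hfin (measure_iUnion_null fun τ => ?_))
  by_cases hτ : P {ω | S ω = (τ : Set ι)} = 0
  · exact measure_mono_null inter_subset_left hτ
  by_cases hmem : i ∈ τ ∧ j ∈ τ ∧ k ∈ τ
  · have h1 := hac τ hτ i hmem.1 j hmem.2.1 k hmem.2.2 hd.1 hd.2.1 hd.2.2 hρN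
    have hmeas : MeasurableSet {ω | S ω = (τ : Set ι)} := hS (measurableSet_singleton _)
    have hφX : Measurable fun ω => φ (X i ω, X j ω, X k ω) :=
      hφ.comp ((hX i).prodMk ((hX j).prodMk (hX k)))
    rw [Measure.map_apply hφX hN, cond_apply hmeas] at h1
    rcases mul_eq_zero.1 h1 with h2 | h2
    · exact absurd h2 (ENNReal.inv_ne_zero.2 (measure_ne_top P _))
    · refine measure_mono_null ?_ h2
      exact fun ω hω => ⟨hω.1, hω.2.1⟩
  · refine measure_mono_null (t := ∅) ?_ measure_empty
    rintro ω ⟨h1, -, h2, h3, h4⟩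
    rw [mem_ofPred_eq] at h1
    rw [h1] at h2 h3 h4
    exact hmem ⟨h2, h3, h4⟩

end TripleLaw

end PoissonCluster

namespace PoissonCluster

/-! ### Absolute continuity of linear images -/

section LinearForms

theorem pi_fin_absolutelyContinuous : ∀ {n : ℕ} (p : Fin n → Measure ℝ) [∀ i, SigmaFinite (p i)],
    (∀ i, p i ≪ volume) → Measure.pi p ≪ (volume : Measure (Fin n → ℝ))
  | 0, p, _, _ => by
    rw [volume_pi, Measure.pi_of_empty p 0, Measure.pi_of_empty _ 0]
  | n + 1, p, _, h => by
    have ih := pi_fin_absolutelyContinuous (fun j => p (Fin.succAbove 0 j)) fun j => h _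
    have e1 := (measurePreserving_piFinSuccAbove p 0).symm.map_eq
    have e2 := (measurePreserving_piFinSuccAbove (fun _ : Fin (n + 1) => (volume : Measure ℝ))
      0).symm.map_eq
    rw [volume_pi, ← e1, ← e2]
    exact ((h 0).prod ih).map (MeasurableEquiv.measurable _)

/-- Three distinct vertices of a cube are not collinear. -/
theorem surjective_of_zero_one {ι : Type*} [Fintype ι] {a b c : ι → ℝ}
    (ha : ∀ i, a i = 0 ∨ a i = 1) (hb : ∀ i, b i = 0 ∨ b i = 1) (hc : ∀ i, c i = 0 ∨ c i = 1)
    (hab : a ≠ b) (hac : a ≠ c) (hbc : b ≠ c) (L : (ι → ℝ) →ₗ[ℝ] ℝ × ℝ)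
    (hL : ∀ x, L x = (∑ i, (b i - a i) * x i, ∑ i, (c i - a i) * x i)) :
    Function.Surjective L := by
  classical
  rw [← LinearMap.range_eq_top]
  by_contra hne
  -- A proper range is killed by a nonzero functional `(s, t) ↦ s * α + t * β`; basis vectors turn
  -- this into one relation per coordinate.
  obtain ⟨φ, hφ, hle⟩ := Submodule.exists_le_ker_of_lt_top _ (lt_top_iff_ne_top.2 hne)
  set α := φ (1, 0)
  set β := φ (0, 1)
  have hφ' : ∀ s t : ℝ, φ (s, t) = s * α + t * β := by
    intro s t
    have : ((s, t) : ℝ × ℝ) = s • (1, 0) + t • (0, 1) := by simp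
    rw [this, map_add, map_smul, map_smul, smul_eq_mul, smul_eq_mul]
  have key : ∀ i, (b i - a i) * α + (c i - a i) * β = 0 := by
    intro i
    have h1 : φ (L (Pi.single i 1)) = 0 := hle (LinearMap.mem_range_self L _)
    rw [hL, hφ'] at h1
    simpa [Pi.single_apply] using h1
  by_cases hα : α = 0
  · by_cases hβ : β = 0
    · apply hφ
      ext <;> simp [hφ', hα, hβ]
    · refine hac (funext fun i => ?_)
      have := key i
      rw [hα, mul_zero, zero_add] at this
      linarith [(mul_eq_zero.1 this).resolve_right hβ]
  by_cases hβ : β = 0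
  · refine hab (funext fun i => ?_)
    have := key i
    rw [hβ, mul_zero, add_zero] at this
    linarith [(mul_eq_zero.1 this).resolve_right hα]
  by_cases hαβ : α + β = 0
  · refine hbc (funext fun i => ?_)
    have h1 := key i
    have : (b i - c i) * α = 0 := by
      rw [eq_neg_of_add_eq_zero_right hαβ] at h1
      linarith
    linarith [(mul_eq_zero.1 this).resolve_right hα]
  -- With `α`, `β` and `α + β` all nonzero, the relation at `i` excludes every 0/1 pattern except `a
  -- i = b i = c i`.
  · refine hab (funext fun i => ?_)
    have h1 := key i
    rcases ha i with h | h <;> rcases hb i with h' | h' <;> rcases hc i with h'' | h'' <;>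
      rw [h, h', h''] at h1 <;> rw [h, h'] <;> exfalso <;>
      first | exact hα (by linarith) | exact hβ (by linarith) | exact hαβ (by linarith)

variable {Ω : Type*} [MeasurableSpace Ω] {P : Measure Ω} [IsProbabilityMeasure P]

theorem map_linear_absolutelyContinuous {n : ℕ} {Y : Fin n → Ω → ℝ} (hY : ∀ i, Measurable (Y i))
    (hi : iIndepFun Y P) (hac : ∀ i, P.map (Y i) ≪ volume) (L : (Fin n → ℝ) →ₗ[ℝ] ℝ × ℝ)
    (hL : Function.Surjective L) : P.map (fun ω => L fun i => Y i ω) ≪ volume := by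
  have hLm : Measurable L := L.continuous_of_finiteDimensional.measurable
  have hprob : ∀ i, IsProbabilityMeasure (P.map (Y i)) := fun i =>
    Measure.isProbabilityMeasure_map (hY i).aemeasurable
  have h1 : P.map (fun ω i => Y i ω) ≪ (volume : Measure (Fin n → ℝ)) := by
    rw [(iIndepFun_iff_map_fun_eq_pi_map fun i => (hY i).aemeasurable).1 hi]
    exact pi_fin_absolutelyContinuous _ hac
  -- The factor `c` may be infinite, when the kernel is nontrivial; only null sets matter here.
  obtain ⟨c, -, hc⟩ := L.exists_map_addHaar_eq_smul_addHaar (volume : Measure (Fin n → ℝ))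
    (volume : Measure (ℝ × ℝ)) hL
  have h2 := h1.map hLm
  rw [hc, Measure.map_map hLm (measurable_pi_lambda _ hY)] at h2
  exact h2.trans (Measure.smul_absolutelyContinuous)

/-- Differences of three distinct sub-sums of independent variables with densities have a joint
density. -/
theorem map_sums_absolutelyContinuous {ι : Type*} [Fintype ι] {Y : ι → Ω → ℝ}
    (hY : ∀ i, Measurable (Y i)) (hi : iIndepFun Y P) (hac : ∀ i, P.map (Y i) ≪ volume)
    {a b c : ι → ℝ} (ha : ∀ i, a i = 0 ∨ a i = 1) (hb : ∀ i, b i = 0 ∨ b i = 1)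
    (hc : ∀ i, c i = 0 ∨ c i = 1) (hab : a ≠ b) (hac' : a ≠ c) (hbc : b ≠ c) :
    P.map (fun ω => (∑ i, b i * Y i ω - ∑ i, a i * Y i ω, ∑ i, c i * Y i ω - ∑ i, a i * Y i ω)) ≪
      (volume : Measure (ℝ × ℝ)) := by
  classical
  let e := (Fintype.equivFin ι).symm
  let L : (Fin (Fintype.card ι) → ℝ) →ₗ[ℝ] ℝ × ℝ :=
    LinearMap.prod (∑ i, (b (e i) - a (e i)) • LinearMap.proj i)
      (∑ i, (c (e i) - a (e i)) • LinearMap.proj i)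
  have hL : ∀ x, L x = (∑ i, (b (e i) - a (e i)) * x i, ∑ i, (c (e i) - a (e i)) * x i) := by
    intro x
    simp [L]
  have hcomp : ∀ {u v : ι → ℝ}, u ≠ v → (fun i => u (e i)) ≠ fun i => v (e i) :=
    fun huv h => huv (e.surjective.injective_comp_right h)
  have hsurj := surjective_of_zero_one (fun i => ha (e i)) (fun i => hb (e i)) (fun i => hc (e i))
    (hcomp hab) (hcomp hac') (hcomp hbc) L hL
  have h1 := map_linear_absolutelyContinuous (Y := fun i => Y (e i)) (fun i => hY _)
    (hi.precomp e.injective) (fun i => hac _) L hsurj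
  convert h1 using 3 with ω
  rw [hL, ← Finset.sum_sub_distrib, ← Finset.sum_sub_distrib]
  congr 1
  · rw [← e.sum_comp]
    exact Finset.sum_congr rfl fun i _ => by ring
  · rw [← e.sum_comp]
    exact Finset.sum_congr rfl fun i _ => by ring

end LinearForms

/-! ### Vertex positions as 0/1 combinations of displacements -/

section Positions

theorem mem_of_isPrefix {τ : Finset (List ℕ)} (hτ : ∀ (v : List ℕ) (i : ℕ), v ++ [i] ∈ τ → v ∈ τ)
    {u : List ℕ} : ∀ {v : List ℕ}, v ∈ τ → u <+: v → u ∈ τ := by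
  intro v
  induction v using List.reverseRecOn with
  | nil =>
    intro hv hu
    rwa [List.prefix_nil.1 hu]
  | append_singleton v i ih =>
    intro hv hu
    rcases List.prefix_concat_iff.1 hu with rfl | h
    · exact hv
    · exact ih (hτ v i hv) h

instance (τ : Finset (List ℕ)) : Fintype {e : List ℕ // e ∈ τ ∧ e ≠ []} :=
  Fintype.subtype (τ.filter (· ≠ [])) (by simp)

-- An edge is named by its lower endpoint, a nonempty word. The edges on the path to `v` are the
-- nonempty prefixes of `v`, all in `τ` because `τ` is closed under parents.
open Classical in
theorem position_eq_sum {τ : Finset (List ℕ)}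
    (hτ : ∀ (v : List ℕ) (i : ℕ), v ++ [i] ∈ τ → v ∈ τ) (D : List ℕ → ℝ) {v : List ℕ}
    (hv : v ∈ τ) :
    position D v = ∑ e : {e : List ℕ // e ∈ τ ∧ e ≠ []}, (if e.1 <+: v then 1 else 0) * D e.1 := by
  simp only [ite_mul, one_mul, zero_mul]
  rw [← Finset.sum_filter, position]
  refine Finset.sum_bij (fun k hk => ⟨v.take (k + 1),
    mem_of_isPrefix hτ hv (List.take_prefix _ _), ?_⟩) ?_ ?_ ?_ ?_
  · have hk' := Finset.mem_range.1 hk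
    intro h
    have := congrArg List.length h
    simp at this
    subst this
    simp at hk'
  · intro k hk
    simp [List.take_prefix]
  · intro k hk l hl h
    have hk' := Finset.mem_range.1 hk
    have hl' := Finset.mem_range.1 hl
    have := congrArg (fun e => e.1.length) h
    simp only [List.length_take] at this
    omega
  · rintro ⟨e, he, hne⟩ h
    have hpre : e <+: v := by simpa using h
    have hlen : 0 < e.length := List.length_pos_of_ne_nil hne
    refine ⟨e.length - 1, Finset.mem_range.2 (by have := hpre.length_le; omega), ?_⟩
    apply Subtype.ext
    change v.take (e.length - 1 + 1) = e
    rw [Nat.sub_add_cancel hlen]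
    exact (List.prefix_iff_eq_take.1 hpre).symm
  · intro k hk
    rfl

-- A nonempty `v` is an edge label and a prefix of itself, and the empty word is a prefix of
-- everything. Equal vectors therefore make `v` and `w` prefixes of each other.
open Classical in
theorem indicator_prefix_ne {τ : Finset (List ℕ)} {v w : List ℕ} (hv : v ∈ τ) (hw : w ∈ τ)
    (hvw : v ≠ w) :
    (fun e : {e : List ℕ // e ∈ τ ∧ e ≠ []} => if e.1 <+: v then (1 : ℝ) else 0) ≠
      fun e => if e.1 <+: w then 1 else 0 := by
  intro h
  have hpre : ∀ {v w : List ℕ}, v ∈ τ → ((fun e : {e : List ℕ // e ∈ τ ∧ e ≠ []} =>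
      if e.1 <+: v then (1 : ℝ) else 0) = fun e => if e.1 <+: w then 1 else 0) → v <+: w := by
    intro v w hv h
    by_cases hne : v = []
    · rw [hne]
      exact List.nil_prefix
    · have := congrFun h ⟨v, hv, hne⟩
      by_contra hcon
      simp [hcon] at this
  have h1 := hpre hv h
  exact hvw (h1.eq_of_length (le_antisymm h1.length_le (hpre hw h.symm).length_le))

variable {Ω : Type*} [MeasurableSpace Ω] {T : Ω → Set (List ℕ)} {D : List ℕ → Ω → ℝ}
  {P : Measure Ω}

namespace IsBranchingCluster

variable (h : IsBranchingCluster T D P)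

include h

/-- An almost sure property of the tree must hold for any single tree of positive probability. -/
theorem parent_mem_of_measure_ne_zero {τ : Finset (List ℕ)}
    (hτ : P {ω | T ω = (τ : Set (List ℕ))} ≠ 0) (v : List ℕ) (i : ℕ) (hv : v ++ [i] ∈ τ) :
    v ∈ τ := by
  by_contra hcon
  refine hτ (measure_mono_null (fun ω hω => ?_) h.parent_mem)
  rw [mem_ofPred_eq] at hω
  intro hall
  have := hall v i (by rw [hω]; exact hv)
  rw [hω] at this
  exact hcon this

theorem measurable_position (v : List ℕ) : Measurable fun ω => position (fun u => D u ω) v :=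
  Finset.measurable_sum _ fun _ _ => h.measurable_displacement _

theorem map_position_sub_absolutelyContinuous [IsFiniteMeasure P] {τ : Finset (List ℕ)}
    (hτ : P {ω | T ω = (τ : Set (List ℕ))} ≠ 0) {u v w : List ℕ} (hu : u ∈ τ) (hv : v ∈ τ)
    (hw : w ∈ τ) (huv : u ≠ v) (huw : u ≠ w) (hvw : v ≠ w) :
    (P[|{ω | T ω = (τ : Set (List ℕ))}]).map (fun ω =>
      (position (fun e => D e ω) v - position (fun e => D e ω) u,
        position (fun e => D e ω) w - position (fun e => D e ω) u)) ≪ volume := by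
  classical
  have := cond_isProbabilityMeasure hτ
  have hp := h.parent_mem_of_measure_ne_zero hτ
  simp only [position_eq_sum hp _ hu, position_eq_sum hp _ hv, position_eq_sum hp _ hw]
  have h01 : ∀ (v : List ℕ) (e : {e : List ℕ // e ∈ τ ∧ e ≠ []}),
      (if e.1 <+: v then (1 : ℝ) else 0) = 0 ∨ (if e.1 <+: v then (1 : ℝ) else 0) = 1 := by
    intro v e
    split_ifs <;> simp
  exact map_sums_absolutelyContinuous (Y := fun e : {e : List ℕ // e ∈ τ ∧ e ≠ []} => D e.1)
    (fun e => h.measurable_displacement _) (h.indep τ hτ)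
    (fun e => (h.density τ hτ e.1 e.2.1 e.2.2).absolutelyContinuous) (h01 u) (h01 v) (h01 w)
    (indicator_prefix_ne hu hv huv) (indicator_prefix_ne hu hw huw) (indicator_prefix_ne hv hw hvw)

end IsBranchingCluster

end Positions

end PoissonCluster

/-! ### Disintegration and the main theorem -/

namespace PoissonCluster

theorem tripleSum_one (N : Measure ℝ) :
    tripleSum N (fun _ => 1) (fun _ => 1) (fun _ => 1) =
      (N univ).toReal * ((N univ).toReal - 1) * ((N univ).toReal - 2) := by
  simp only [tripleSum, mul_one, integral_const, smul_eq_mul, measureReal_def]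
  ring

/-- Disintegration of the integrals of the translates of a finite measure on `ℝ³` with respect to
the first coordinate. -/
theorem integral_translates_eq (Λ : Measure (ℝ × ℝ × ℝ)) [IsFiniteMeasure Λ] {f g h : ℝ → ℝ}
    (hf : IsTest f) (hg : IsTest g) (hh : IsTest h) :
    ∫ u, ∫ x, f (x.1 + u) * g (x.2.1 + u) * h (x.2.2 + u) ∂Λ =
      ∫ t, ∫ x, f t * g (t + (x.2.1 - x.1)) * h (t + (x.2.2 - x.1)) ∂Λ := by
  obtain ⟨b, hb⟩ := hg.bounded
  obtain ⟨c, hc⟩ := hh.bounded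
  have mf := hf.measurable
  have mg := hg.measurable
  have mh := hh.measurable
  have hfi : Integrable f volume := hf.integrable volume
  have hfΛ : Integrable (fun p : ℝ × (ℝ × ℝ × ℝ) => f p.1) (volume.prod Λ) := hfi.comp_fst Λ
  have hfΛ' : Integrable (fun p : ℝ × (ℝ × ℝ × ℝ) => f (p.2.1 + p.1)) (volume.prod Λ) := by
    have hm : Measurable fun p : ℝ × (ℝ × ℝ × ℝ) => f (p.2.1 + p.1) := by fun_prop
    refine (integrable_prod_iff' hm.aestronglyMeasurable).2
      ⟨ae_of_all _ fun x => hfi.comp_add_left x.1, ?_⟩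
    have : ∀ x : ℝ × ℝ × ℝ, ∫ u, ‖f (x.1 + u)‖ = ∫ u, ‖f u‖ := fun x =>
      integral_add_left_eq_self (fun u => ‖f u‖) x.1
    simp only [this]
    exact integrable_const _
  -- Integrability over `volume.prod Λ` comes from the factor `f` alone, with `Λ` finite; the other
  -- two factors need only be bounded.
  have bound : ∀ s t : ℝ, ‖g s * h t‖ ≤ b * c := fun s t => by
    rw [norm_mul]
    exact mul_le_mul (hb s) (hc t) (abs_nonneg _) ((abs_nonneg _).trans (hb s))
  have i1 : Integrable (fun p : ℝ × (ℝ × ℝ × ℝ) => f (p.2.1 + p.1) * g (p.2.2.1 + p.1)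
      * h (p.2.2.2 + p.1)) (volume.prod Λ) := by
    simp only [mul_assoc]
    exact hfΛ'.mul_bdd (c := b * c) (by fun_prop) (ae_of_all _ fun p => bound _ _)
  have i2 : Integrable (fun p : ℝ × (ℝ × ℝ × ℝ) => f p.1 * g (p.1 + (p.2.2.1 - p.2.1))
      * h (p.1 + (p.2.2.2 - p.2.1))) (volume.prod Λ) := by
    simp only [mul_assoc]
    exact hfΛ.mul_bdd (c := b * c) (by fun_prop) (ae_of_all _ fun p => bound _ _)
  rw [integral_integral_swap (f := fun (u : ℝ) (x : ℝ × ℝ × ℝ) => f (x.1 + u) * g (x.2.1 + u) * h (x.2.2 + u)) i1,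
    integral_integral_swap
      (f := fun (t : ℝ) (x : ℝ × ℝ × ℝ) => f t * g (t + (x.2.1 - x.1)) * h (t + (x.2.2 - x.1))) i2]
  refine integral_congr_ae (ae_of_all _ fun x => ?_)
  have := integral_add_left_eq_self (μ := volume)
    (fun t => f t * g (t + (x.2.1 - x.1)) * h (t + (x.2.2 - x.1))) x.1
  refine Eq.trans (integral_congr_ae (ae_of_all _ fun u => ?_)) this
  have e1 : x.1 + u + (x.2.1 - x.1) = x.2.1 + u := by ring
  have e2 : x.1 + u + (x.2.2 - x.1) = x.2.2 + u := by ring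
  simp only [e1, e2]

theorem IsTest.comp_add {f : ℝ → ℝ} (hf : IsTest f) (u : ℝ) :
    Measurable (fun x => f (x + u)) ∧ ∃ b, ∀ x, |f (x + u)| ≤ b := by
  obtain ⟨b, hb⟩ := hf.bounded
  exact ⟨hf.measurable.comp (by fun_prop), b, fun x => hb _⟩

theorem toSignedMeasure_eq_withDensityᵥ {α : Type*} [MeasurableSpace α] (ρ m : Measure α)
    [IsFiniteMeasure ρ] [SigmaFinite m] (h : ρ ≪ m) :
    ρ.toSignedMeasure = m.withDensityᵥ fun x => (ρ.rnDeriv m x).toReal := by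
  ext s hs
  rw [withDensityᵥ_apply Measure.integrable_toReal_rnDeriv hs,
    Measure.setIntegral_toReal_rnDeriv h, Measure.toSignedMeasure_apply_measurable hs]

end PoissonCluster

theorem mainTheorem7 {Ω₀ Ω : Type*} [MeasurableSpace Ω₀] [MeasurableSpace Ω]
    (P : Measure Ω₀) [IsProbabilityMeasure P] (μ : Measure Ω) [IsProbabilityMeasure μ]
    (T : Ω₀ → Set (List ℕ)) (D : List ℕ → Ω₀ → ℝ)
    (hC : PoissonCluster.IsBranchingCluster T D P)
    (hmoment : ∫⁻ ω, (PoissonCluster.cluster T D ω univ) ^ 3 ∂P < ∞)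
    (ν : ℝ≥0) (hν : 0 < ν) (U : ℕ → Ω → ℝ) (C : ℕ → Ω → Measure ℝ)
    (hN : PoissonCluster.IsPoissonClusterSystem U C ν μ (PoissonCluster.cluster T D) P) :
    ∃ κ : SignedMeasure (ℝ × ℝ),
      PoissonCluster.IsReducedThirdFactorialCumulant (PoissonCluster.clusterProcess U C) μ κ ∧
      ∃ c₃ : ℝ × ℝ → ℝ, Integrable c₃ volume ∧
        κ = (volume : Measure (ℝ × ℝ)).withDensityᵥ c₃ ∧
        ∫ τ, c₃ τ = ν * ∫ ω, (PoissonCluster.cluster T D ω univ).toReal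
          * ((PoissonCluster.cluster T D ω univ).toReal - 1)
          * ((PoissonCluster.cluster T D ω univ).toReal - 2) ∂P := by
  -- Vertices carry the discrete σ-algebra, so that triples of vertices can be integrated against
  -- `Measure.count`.
  let _ : MeasurableSpace (List ℕ) := ⊤
  have hdisc : DiscreteMeasurableSpace (List ℕ) := ⟨fun _ => trivial⟩
  have hT := hC.measurable_tree
  set X : List ℕ → Ω₀ → ℝ := fun v ω => PoissonCluster.position (fun u => D u ω) v with hX
  have hXm : ∀ v, Measurable (X v) := fun v => hC.measurable_position v
  set Λ : Measure (ℝ × ℝ × ℝ) := PoissonCluster.tripleLaw T X P with hΛ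
  have hΛfin : IsFiniteMeasure Λ :=
    PoissonCluster.isFiniteMeasure_tripleLaw hT hXm hC.finite hmoment
  have htriple : ∀ {f g h : ℝ → ℝ}, Measurable f → Measurable g → Measurable h →
      (∃ b, ∀ x, |f x| ≤ b) → (∃ b, ∀ x, |g x| ≤ b) → (∃ b, ∀ x, |h x| ≤ b) →
      ∫ ω, PoissonCluster.tripleSum (PoissonCluster.cluster T D ω) f g h ∂P =
        ∫ x, f x.1 * g x.2.1 * h x.2.2 ∂Λ := fun mf mg mh bf bg bh =>
    PoissonCluster.integral_tripleSum_eq hT hXm hC.finite mf mg mh bf bg bh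
  set φ : ℝ × ℝ × ℝ → ℝ × ℝ := fun x => (x.2.1 - x.1, x.2.2 - x.1) with hφ
  have hφm : Measurable φ := by fun_prop
  have hac : Λ.map φ ≪ volume :=
    PoissonCluster.map_tripleLaw_absolutelyContinuous hT hXm hC.finite hφm
      fun τ hτ i hi j hj k hk hij hik hjk =>
        hC.map_position_sub_absolutelyContinuous hτ hi hj hk hij hik hjk
  have hac' : ν • Λ.map φ ≪ volume := hac.smul_left ν
  -- The reduced cumulant measure is the positive measure `ν • Λ.map φ`, and `c₃` is its
  -- Radon–Nikodym derivative.
  refine ⟨(ν • Λ.map φ).toSignedMeasure, ⟨fun K hK =>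
    hN.lintegral_clusterProcess_cube_lt_top hmoment hν hK, fun f₀ f₁ f₂ h₀ h₁ h₂ => ?_⟩,
    fun τ => ((ν • Λ.map φ).rnDeriv volume τ).toReal, Measure.integrable_toReal_rnDeriv,
    PoissonCluster.toSignedMeasure_eq_withDensityᵥ _ _ hac', ?_⟩
  · have m₀ := h₀.measurable
    have m₁ := h₁.measurable
    have m₂ := h₂.measurable
    rw [hN.thirdFactorialCumulant_eq hmoment hν h₀ h₁ h₂]
    have e1 : ∀ u, ∫ ω, PoissonCluster.tripleSum (PoissonCluster.cluster T D ω)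
        (fun x => f₀ (x + u)) (fun x => f₁ (x + u)) (fun x => f₂ (x + u)) ∂P =
        ∫ x, f₀ (x.1 + u) * f₁ (x.2.1 + u) * f₂ (x.2.2 + u) ∂Λ := fun u =>
      htriple (h₀.comp_add u).1 (h₁.comp_add u).1 (h₂.comp_add u).1 (h₀.comp_add u).2
        (h₁.comp_add u).2 (h₂.comp_add u).2
    simp only [e1]
    rw [PoissonCluster.integral_translates_eq Λ h₀ h₁ h₂, ← integral_const_mul]
    refine integral_congr_ae (ae_of_all _ fun t => ?_)
    have hm : Measurable fun τ : ℝ × ℝ => f₀ t * f₁ (t + τ.1) * f₂ (t + τ.2) := by fun_prop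
    simp only [VectorMeasure.integral_toSignedMeasure]
    rw [integral_smul_nnreal_measure, integral_map hφm.aemeasurable hm.aestronglyMeasurable,
      NNReal.smul_def, smul_eq_mul]
  · rw [Measure.integral_toReal_rnDeriv hac']
    -- Constant functions identify the mass of `Λ` with the third factorial moment of the cluster
    -- size.
    have h1 := htriple (f := fun _ => 1) (g := fun _ => 1) (h := fun _ => 1) measurable_const
      measurable_const measurable_const ⟨1, by simp⟩ ⟨1, by simp⟩ ⟨1, by simp⟩
    simp only [PoissonCluster.tripleSum_one] at h1
    rw [h1, measureReal_def, Measure.smul_apply, Measure.map_apply hφm MeasurableSet.univ]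
    simp [measureReal_def, ENNReal.smul_def]
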